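/- **Setting.** Let $n,m\ge 1$ be integers, let $\Omega\subset\mathbb R^n$ be a bounded open set and $1<q\le p<\infty$. Let $Q\subset\mathbb R^m$ be a convex body with the origin in its interior and support function $h_Q(u)=\sup_{y\in Q}\langle y,u\rangle$. View $y\in\mathbb R^{nm}$ as an $n\times m$ matrix with transpose $y^t$, and assume that for every $y\in\mathbb R^{nm}$ the function $\xi\mapsto h_Q(y^t\xi)$ is of class $C^2$ on $\{\xi\in\mathbb R^n: y^t\xi\neq 0\}$ (this holds for example if $h_Q\in C^2(\mathbb R^m\setminus\{0\})$). Let $W^{1,p}_0(\Omega)$ be the completion of $C_c^\infty(\Omega)$ in the norm $\|\,|\nabla f|\,\|_{L^p}$; its elements and their gradients are extended by zero to $\mathbb R^n$. Let $\omega_n$ be the volume of the Euclidean unit ball $B_2^n$ of $\mathbb R^n$, let $d\theta$ and $dv$ denote spherical Lebesgue measure, and write $|A|$ for the Lebesgue measure of $A\subset\mathbb R^{nm}$. Put $$\Pi^\circ B=\Big\{u\in\mathbb R^{nm}:\int_{\mathbb S^{n-1}}h_Q(u^tv)^p\,dv\le 1\Big\},\qquad d_{n,p}(Q)=(n\omega_n)^{1/p}\,(nm\,|\Pi^\circ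 B|)^{1/(nm)} .$$ For $f\in W_0^{1,p}(\Omega)\setminus\{0\}$ and $\theta\in\mathbb R^{nm}$ put $$\|\theta\|_f=\Big(\int_{\mathbb R^n}h_Q(\theta^t\nabla f(x))^p\,dx\Big)^{1/p},\qquad \Pi^\circ f=\{\theta\in\mathbb R^{nm}:\|\theta\|_f\le 1\},$$ $$\mathcal E_{Q,p}f=d_{n,p}(Q)\Big(\int_{\mathbb S^{nm-1}}\|\theta\|_f^{-nm}\,d\theta\Big)^{-1/(nm)},$$ and let $L_{Q,p,f}\subset\mathbb R^n$ be the convex body with support function $$h_{L_{Q,p,f}}(z)=\Big(\frac{m}{(nm+p)\omega_n}\Big)^{-1/p}\Big(\frac{|\Pi^\circ B|}{|\Pi^\circ f|}\Big)^{1/(nm)}\Big(\frac1{|\Pi^\circ f|}\int_{\Pi^\circ f}h_Q(x^tz)^p\,dx\Big)^{1/p}.$$ The affine $p$-Laplacian is $\Delta^{\mathcal A}_{Q,p}f=-\operatorname{div}\big(h_{L_{Q,p,f}}(\nabla f)^{p-1}\,\nabla h_{L_{Q,p,f}}(\nabla f)\big)$, where the field is taken to be $0$ where $\nabla f=0$.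 A function $f\in W_0^{1,p}(\Omega)\setminus\{0\}$ is a *weak solution of $\Delta^{\mathcal A}_{Q,p}f=r$ in $\Omega$ with zero boundary data* if for every $\varphi\in W^{1,p}_0(\Omega)$ both integrals below converge absolutely and $$\int_\Omega\big\langle h_{L_{Q,p,f}}(\nabla f)^{p-1}\,\nabla h_{L_{Q,p,f}}(\nabla f),\nabla\varphi\big\rangle\,dx=\int_\Omega r\,\varphi\,dx .$$ Finally let $$\lambda^{\mathcal A,q}_{1,p}=\inf_{0\ne g\in W^{1,p}_0(\Omega)}\frac{\mathcal E_{Q,p}g}{\|g\|_{L^q(\Omega)}},\qquad \lambda^{\mathcal A}_{1,p}=\inf_{0\ne g\in W^{1,p}_0(\Omega)}\frac{(\mathcal E_{Q,p}g)^p}{\|g\|_{L^p(\Omega)}^p}.$$ **Proposition 4.4.** (1) If $f\in W^{1,p}_0(\Omega)\setminus\{0\}$ satisfies $\mathcal E_{Q,p}f/\|f\|_{L^q(\Omega)}=\lambda^{\mathcal A,q}_{1,p}$, then $f$ is a weak solution, with zero boundary data, of $$\Delta^{\mathcal A}_{Q,p}f=(\lambda^{\mathcal A,q}_{1,p})^p\,\|f\|_{L^q(\Omega)}^{p-q}\,|f|^{q-2}f\quad\text{in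 }\Omega .$$ (2) If $f\in W^{1,p}_0(\Omega)\setminus\{0\}$ satisfies $(\mathcal E_{Q,p}f)^p/\|f\|_{L^p(\Omega)}^p=\lambda^{\mathcal A}_{1,p}$, then $f$ is a first Dirichlet eigenfunction of $\Delta^{\mathcal A}_{Q,p}$: it is a weak solution, with zero boundary data, of $\Delta^{\mathcal A}_{Q,p}f=\lambda^{\mathcal A}_{1,p}|f|^{p-2}f$ in $\Omega$, and $\lambda^{\mathcal A}_{1,p}$ is the smallest real number $\mu$ for which $\Delta^{\mathcal A}_{Q,p}g=\mu|g|^{p-2}g$ has a nonzero weak solution $g\in W^{1,p}_0(\Omega)$ with zero boundary data. -/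

import Mathlib

open MeasureTheory Filter Topology
open scoped ENNReal ContDiff

noncomputable section

namespace AffineLaplace

/-- Euclidean space of dimension `n`. -/
abbrev Vec (n : ℕ) : Type := EuclideanSpace ℝ (Fin n)

/-- The space of real `n × m` matrices, identified with the Euclidean space of dimension `n * m`
(so it carries the Frobenius norm and Lebesgue measure). -/
abbrev Mat (n m : ℕ) : Type := EuclideanSpace ℝ (Fin n × Fin m)

/-- The vector `θᵗ v` for an `n × m` matrix `θ` and a vector `v` with `n` coordinates. -/
def tmul {n m : ℕ} (θ : Mat n m) (v : Vec n) : Vec m :=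
  WithLp.toLp 2 fun j => ∑ i, θ (i, j) * v i

/-- The support function `h_Q(u) = sup {⟨y, u⟩ : y ∈ Q}`. -/
def supp {m : ℕ} (Q : ConvexBody (Vec m)) (u : Vec m) : ℝ :=
  sSup ((fun y : Vec m => inner ℝ y u) '' (Q : Set (Vec m)))

/-- Convex bodies `Q` with the origin in their interior and such that, for every `n × m` matrix
`y`, the function `ξ ↦ h_Q(yᵗ ξ)` is of class `C²` wherever `yᵗ ξ ≠ 0`. This holds for instance
whenever `h_Q` is of class `C²` away from the origin. -/
def Admissible (n : ℕ) {m : ℕ} (Q : ConvexBody (Vec m)) : Prop :=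
  (0 : Vec m) ∈ interior (Q : Set (Vec m)) ∧
    ∀ y : Mat n m, ContDiffOn ℝ 2 (fun ξ : Vec n => supp Q (tmul y ξ)) {ξ | tmul y ξ ≠ 0}

/-- An element of `W₀^{1,p}(Ω)` together with its weak gradient, both extended by zero to the whole
space: the pair `(f, ∇f)` is a limit in `L^p` of pairs `(φ, ∇φ)`, where the `φ` are smooth functions
with compact support in `Ω`. -/
structure SobolevZero {n : ℕ} (Ω : Set (Vec n)) (p : ℝ) where
  /-- A representative of the function. -/
  toFun : Vec n → ℝ
  /-- A representative of its weak gradient. -/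
  grad : Vec n → Vec n
  memLp_toFun : MemLp toFun (ENNReal.ofReal p) volume
  memLp_grad : MemLp grad (ENNReal.ofReal p) volume
  exists_approx : ∃ φ : ℕ → Vec n → ℝ,
    (∀ k, ContDiff ℝ ∞ (φ k) ∧ HasCompactSupport (φ k) ∧ tsupport (φ k) ⊆ Ω) ∧
    Tendsto (fun k => eLpNorm (fun x => φ k x - toFun x) (ENNReal.ofReal p) volume)
      atTop (𝓝 0) ∧
    Tendsto (fun k => eLpNorm (fun x => gradient (φ k) x - grad x) (ENNReal.ofReal p) volume)
      atTop (𝓝 0)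

/-- The element is nonzero in `W₀^{1,p}(Ω)`, i.e. the function does not vanish almost everywhere. -/
def SobolevZero.Nonzero {n : ℕ} {Ω : Set (Vec n)} {p : ℝ} (f : SobolevZero Ω p) : Prop :=
  ¬ f.toFun =ᵐ[volume] 0

/-- `‖f‖_{L^q(Ω)}`. -/
def lqNorm {n : ℕ} (Ω : Set (Vec n)) (q : ℝ) (f : Vec n → ℝ) : ℝ :=
  (∫ x in Ω, |f x| ^ q) ^ (1 / q)

/-- The volume `ω_n` of the Euclidean unit ball of dimension `n`. -/
def omega (n : ℕ) : ℝ := volume.real (Metric.ball (0 : Vec n) 1)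

/-- The gauge of the polar projection body of the Euclidean unit ball,
`u ↦ (∫ h_Q(uᵗ v)^p dv)^{1/p}`, the integral being over the unit sphere. The `L^p` surface area
measure of the unit ball is the spherical Lebesgue measure, for every `p`. -/
def ballGauge (n : ℕ) {m : ℕ} (Q : ConvexBody (Vec m)) (p : ℝ) (u : Mat n m) : ℝ :=
  (∫ v : Metric.sphere (0 : Vec n) 1, supp Q (tmul u v) ^ p ∂(volume : Measure (Vec n)).toSphere)
    ^ (1 / p)

/-- The polar projection body of the Euclidean unit ball. -/
def ballPolarProj (n : ℕ) {m : ℕ} (Q : ConvexBody (Vec m)) (p : ℝ) : Set (Mat n m) :=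
  {u | ballGauge n Q p u ≤ 1}

/-- `‖h_Q(θᵗ G(·))‖_{L^p}` for a vector field `G`; with `G = ∇f` this is the gauge of the polar
projection body of `f`. -/
def fieldGauge {n m : ℕ} (Q : ConvexBody (Vec m)) (p : ℝ) (G : Vec n → Vec n) (θ : Mat n m) : ℝ :=
  (∫ x, supp Q (tmul θ (G x)) ^ p) ^ (1 / p)

/-- The polar projection body of a function with gradient `G`. -/
def polarProj {n m : ℕ} (Q : ConvexBody (Vec m)) (p : ℝ) (G : Vec n → Vec n) : Set (Mat n m) :=
  {θ | fieldGauge Q p G θ ≤ 1}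

/-- The constant `d_{n,p}(Q)`. -/
def dConst (n : ℕ) {m : ℕ} (Q : ConvexBody (Vec m)) (p : ℝ) : ℝ :=
  ((n : ℝ) * omega n) ^ (1 / p) *
    ((n : ℝ) * m * volume.real (ballPolarProj n Q p)) ^ (1 / ((n : ℝ) * m))

/-- The affine Sobolev energy of a function with gradient `G`. -/
def energy {n m : ℕ} (Q : ConvexBody (Vec m)) (p : ℝ) (G : Vec n → Vec n) : ℝ :=
  dConst n Q p *
    (∫ θ : Metric.sphere (0 : Mat n m) 1, fieldGauge Q p G θ ^ (-((n : ℝ) * m))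
      ∂(volume : Measure (Mat n m)).toSphere) ^ (-(1 / ((n : ℝ) * m)))

/-- The support function of the centroid body of a set `L` of `n × m` matrices. -/
def centroidSupp {n m : ℕ} (Q : ConvexBody (Vec m)) (p : ℝ) (L : Set (Mat n m)) (v : Vec n) : ℝ :=
  ((volume.real L)⁻¹ * ∫ x in L, supp Q (tmul x v) ^ p) ^ (1 / p)

/-- The support function of the convex body `L_{Q,p,f}`, where `G = ∇f`: a dilate of the centroid
body of the polar projection body of `f`. -/
def suppL {n m : ℕ} (Q : ConvexBody (Vec m)) (p : ℝ) (G : Vec n → Vec n) (z : Vec n) : ℝ :=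
  ((m : ℝ) / (((n : ℝ) * m + p) * omega n)) ^ (-(1 / p)) *
    (volume.real (ballPolarProj n Q p) / volume.real (polarProj Q p G)) ^ (1 / ((n : ℝ) * m)) *
    centroidSupp Q p (polarProj Q p G) z

/-- The vector field `h_L(∇f)^{p-1} ∇h_L(∇f)` with `L = L_{Q,p,f}` and `G = ∇f`; minus its
divergence is the affine `p`-Laplacian of `f`. -/
def flux {n m : ℕ} (Q : ConvexBody (Vec m)) (p : ℝ) (G : Vec n → Vec n) (x : Vec n) : Vec n :=
  suppL Q p G (G x) ^ (p - 1) • gradient (suppL Q p G) (G x)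

/-- `f ∈ W₀^{1,p}(Ω)` is a weak solution of `Δ f = r` in `Ω`, `f = 0` on the boundary, for the
affine `p`-Laplacian `Δ`: the integrals against every `φ ∈ W₀^{1,p}(Ω)` exist, and they agree. -/
def IsWeakSolution {n m : ℕ} (Q : ConvexBody (Vec m)) {Ω : Set (Vec n)} {p : ℝ}
    (f : SobolevZero Ω p) (r : Vec n → ℝ) : Prop :=
  ∀ φ : SobolevZero Ω p,
    IntegrableOn (fun x => inner ℝ (flux Q p f.grad x) (φ.grad x)) Ω volume ∧
    IntegrableOn (fun x => r x * φ.toFun x) Ω volume ∧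
    ∫ x in Ω, inner ℝ (flux Q p f.grad x) (φ.grad x) = ∫ x in Ω, r x * φ.toFun x

/-- The quotient `E f / ‖f‖_{L^q(Ω)}`. -/
def rayleighQ {n m : ℕ} (Q : ConvexBody (Vec m)) {Ω : Set (Vec n)} {p : ℝ} (q : ℝ)
    (f : SobolevZero Ω p) : ℝ :=
  energy Q p f.grad / lqNorm Ω q f.toFun

/-- The infimum of `E g / ‖g‖_{L^q(Ω)}` over nonzero `g ∈ W₀^{1,p}(Ω)`. -/
def lambdaQ {n m : ℕ} (Q : ConvexBody (Vec m)) (Ω : Set (Vec n)) (p q : ℝ) : ℝ :=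
  sInf {r | ∃ g : SobolevZero Ω p, g.Nonzero ∧ rayleighQ Q q g = r}

/-- The affine Rayleigh quotient `(E f)^p / ‖f‖_{L^p(Ω)}^p`. -/
def rayleigh {n m : ℕ} (Q : ConvexBody (Vec m)) {Ω : Set (Vec n)} {p : ℝ}
    (f : SobolevZero Ω p) : ℝ :=
  energy Q p f.grad ^ p / lqNorm Ω p f.toFun ^ p

/-- The infimum of the affine Rayleigh quotient over nonzero `g ∈ W₀^{1,p}(Ω)`. -/
def lambdaOne {n m : ℕ} (Q : ConvexBody (Vec m)) (Ω : Set (Vec n)) (p : ℝ) : ℝ :=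
  sInf {r | ∃ g : SobolevZero Ω p, g.Nonzero ∧ rayleigh Q g = r}

/-- `f` is an eigenfunction of the affine `p`-Laplacian with zero boundary data and eigenvalue
`μ`. -/
def IsEigenfunction {n m : ℕ} (Q : ConvexBody (Vec m)) {Ω : Set (Vec n)} {p : ℝ} (μ : ℝ)
    (f : SobolevZero Ω p) : Prop :=
  f.Nonzero ∧ IsWeakSolution Q f fun x => μ * (|f.toFun x| ^ (p - 2) * f.toFun x)

end AffineLaplace

end

open AffineLaplace

/-! The affine energy is not an integral functional, since the body `L` depends on the function.
Freezing `L` at the extremal `f` removes this difficulty. Put `H = h_L ^ p` with `L` built from `f`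
(`suppLPow`). For every nonzero `g`, `E(g)^p ≤ ∫ H(∇g)`, with equality at `g = f` (`energy_rpow_le`,
`energy_rpow_eq`, `integral_suppLPow`). By Fubini and polar coordinates, `∫ H(∇g)` is a constant
times the spherical integral of `‖θ‖_g ^ p * ‖θ‖_f ^ (-(nm+p))`, so the inequality is Hölder's
inequality on the sphere (`rpow_integral_sphere_le`).

Consequently, if `f` gives equality in `μ ‖g‖_q^p ≤ E(g)^p`, then `t ↦ ∫ H(∇f + t∇φ) - μ ‖f +
tφ‖_q^p` is nonnegative and vanishes at `t = 0`. Its derivative there is zero, which is the weak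
equation, because `p⁻¹ ∇H = h_L^(p-1) ∇h_L` (`inner_flux`, `isWeakSolution_of_forall_le`). No
derivative of the affine energy itself is needed.

All this requires `‖θ‖_f > 0` for `θ ≠ 0`. Otherwise the derivative of `f` along a nonzero column of
`θ` vanishes, and a one-directional Poincaré inequality on the bounded set `Ω` forces `f = 0`
(`SobolevZero.Nonzero.nondegenerate`).

For minimality of the eigenvalue, an eigenfunction is tested against itself: Euler's identity for
`H` shows that its eigenvalue is its Rayleigh quotient (`IsEigenfunction.rayleigh_eq`). -/

namespace AffineLaplace

/-! ### Support functions and the kernel `h_Q(θᵗ z)^p` -/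

section support

variable {n m : ℕ}

theorem norm_tmul_le (θ : Mat n m) (v : Vec n) : ‖tmul θ v‖ ≤ ‖θ‖ * ‖v‖ := by
  rw [EuclideanSpace.norm_eq, EuclideanSpace.norm_eq, EuclideanSpace.norm_eq,
    ← Real.sqrt_mul (Finset.sum_nonneg fun _ _ => sq_nonneg _)]
  apply Real.sqrt_le_sqrt
  rw [Fintype.sum_prod_type_right, Finset.sum_mul]
  refine Finset.sum_le_sum fun j _ => ?_
  simp only [tmul, Real.norm_eq_abs, sq_abs]
  exact Finset.sum_mul_sq_le_sq_mul_sq _ _ _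

theorem tmul_sub_right (θ : Mat n m) (v w : Vec n) : tmul θ (v - w) = tmul θ v - tmul θ w := by
  ext j; simp [tmul, mul_sub, Finset.sum_sub_distrib]

theorem tmul_smul_right (θ : Mat n m) (a : ℝ) (v : Vec n) : tmul θ (a • v) = a • tmul θ v := by
  ext j
  simp only [tmul, PiLp.smul_apply, smul_eq_mul, Finset.mul_sum]
  exact Finset.sum_congr rfl fun i _ => by ring

theorem tmul_smul_left (θ : Mat n m) (a : ℝ) (v : Vec n) : tmul (a • θ) v = a • tmul θ v := by
  ext j
  simp only [tmul, PiLp.smul_apply, smul_eq_mul, Finset.mul_sum]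
  exact Finset.sum_congr rfl fun i _ => by ring

theorem continuous_tmul : Continuous fun x : Mat n m × Vec n => tmul x.1 x.2 := by
  unfold tmul
  fun_prop

theorem exists_norm_le (Q : ConvexBody (Vec m)) : ∃ C, 0 < C ∧ ∀ y ∈ Q, ‖y‖ ≤ C := by
  obtain ⟨C, hC⟩ := Q.isCompact.isBounded.exists_norm_le
  exact ⟨max C 1, by positivity, fun y hy => (hC y hy).trans (le_max_left _ _)⟩

theorem inner_le_supp (Q : ConvexBody (Vec m)) {y : Vec m} (hy : y ∈ Q) (u : Vec m) :
    inner ℝ y u ≤ supp Q u :=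
  le_csSup ((Q.isCompact.image (by fun_prop)).bddAbove) ⟨y, hy, rfl⟩

theorem supp_le (Q : ConvexBody (Vec m)) {u : Vec m} {a : ℝ}
    (h : ∀ y ∈ Q, inner ℝ y u ≤ a) : supp Q u ≤ a := by
  refine csSup_le (Q.nonempty.image _) ?_
  rintro _ ⟨y, hy, rfl⟩
  exact h y hy

theorem supp_add_le (Q : ConvexBody (Vec m)) (u v : Vec m) :
    supp Q (u + v) ≤ supp Q u + supp Q v :=
  supp_le Q fun y hy => by
    rw [inner_add_right]
    exact add_le_add (inner_le_supp Q hy u) (inner_le_supp Q hy v)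

theorem supp_smul (Q : ConvexBody (Vec m)) {a : ℝ} (ha : 0 < a) (u : Vec m) :
    supp Q (a • u) = a * supp Q u := by
  have key : ∀ b : ℝ, 0 < b → ∀ w, supp Q (b • w) ≤ b * supp Q w := fun b hb w =>
    supp_le Q fun y hy => by
      rw [real_inner_smul_right]
      exact mul_le_mul_of_nonneg_left (inner_le_supp Q hy w) hb.le
  refine le_antisymm (key a ha u) ?_
  -- The reverse inequality is the same one with `a⁻¹` applied to `a • u`.
  have := key a⁻¹ (by positivity) (a • u)
  rw [smul_smul, inv_mul_cancel₀ ha.ne', one_smul] at this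
  rwa [← le_inv_mul_iff₀ (by positivity)]

theorem exists_supp_le_mul_norm (Q : ConvexBody (Vec m)) :
    ∃ C, 0 < C ∧ ∀ u, supp Q u ≤ C * ‖u‖ := by
  obtain ⟨C, hC0, hC⟩ := exists_norm_le Q
  refine ⟨C, hC0, fun u => supp_le Q fun y hy => (real_inner_le_norm y u).trans ?_⟩
  gcongr
  exact hC y hy

theorem supp_nonneg {Q : ConvexBody (Vec m)} (h0 : (0 : Vec m) ∈ interior (Q : Set (Vec m)))
    (u : Vec m) : 0 ≤ supp Q u := by
  simpa using inner_le_supp Q (interior_subset h0 : (0 : Vec m) ∈ (Q : Set (Vec m))) u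

theorem exists_mul_norm_le_supp {Q : ConvexBody (Vec m)}
    (h0 : (0 : Vec m) ∈ interior (Q : Set (Vec m))) : ∃ c, 0 < c ∧ ∀ u, c * ‖u‖ ≤ supp Q u := by
  obtain ⟨r, hr, hb⟩ := Metric.nhds_basis_closedBall.mem_iff.1 (mem_interior_iff_mem_nhds.1 h0)
  refine ⟨r, hr, fun u => ?_⟩
  by_cases hu : u = 0
  · simpa [hu] using supp_nonneg h0 0
  have hu' : ‖u‖ ≠ 0 := norm_ne_zero_iff.2 hu
  -- The supremum is tested at the point in direction `u` on the boundary of a ball contained in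
  -- `Q`.
  have : (r / ‖u‖) • u ∈ (Q : Set (Vec m)) := hb (by
    rw [mem_closedBall_zero_iff, norm_smul, Real.norm_eq_abs, abs_of_pos (by positivity),
      div_mul_cancel₀ _ hu'])
  have h := inner_le_supp Q this u
  rw [real_inner_smul_left, real_inner_self_eq_norm_sq] at h
  calc r * ‖u‖ = r / ‖u‖ * ‖u‖ ^ 2 := by field_simp
    _ ≤ _ := h

theorem supp_zero {Q : ConvexBody (Vec m)} (h0 : (0 : Vec m) ∈ interior (Q : Set (Vec m))) :
    supp Q 0 = 0 :=
  le_antisymm (supp_le Q fun y _ => by simp) (supp_nonneg h0 0)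

theorem supp_eq_zero {Q : ConvexBody (Vec m)} (h0 : (0 : Vec m) ∈ interior (Q : Set (Vec m)))
    {u : Vec m} : supp Q u = 0 ↔ u = 0 := by
  refine ⟨fun h => ?_, fun h => h ▸ supp_zero h0⟩
  obtain ⟨c, hc, hcu⟩ := exists_mul_norm_le_supp h0
  have := hcu u
  rw [h] at this
  exact norm_le_zero_iff.1 (nonpos_of_mul_nonpos_right this hc)

theorem exists_supp_lipschitz (Q : ConvexBody (Vec m)) :
    ∃ C : NNReal, 0 < C ∧ LipschitzWith C (supp Q) := by
  obtain ⟨C, hC0, hC⟩ := exists_supp_le_mul_norm Q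
  refine ⟨⟨C, hC0.le⟩, hC0, LipschitzWith.of_le_add_mul _ fun u v => ?_⟩
  have h1 := supp_add_le Q v (u - v)
  rw [add_sub_cancel] at h1
  rw [dist_eq_norm]
  exact h1.trans (by gcongr; exact hC _)

theorem continuous_supp (Q : ConvexBody (Vec m)) : Continuous (supp Q) :=
  (exists_supp_lipschitz Q).choose_spec.2.continuous

theorem exists_lipschitz_supp_tmul (Q : ConvexBody (Vec m)) : ∃ C : NNReal, 0 < C ∧
    ∀ θ : Mat n m, LipschitzWith (C * ‖θ‖₊) fun v => supp Q (tmul θ v) := by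
  obtain ⟨C, hC0, hC⟩ := exists_supp_lipschitz Q
  refine ⟨C, hC0, fun θ => hC.comp (LipschitzWith.of_dist_le_mul fun v w => ?_)⟩
  rw [dist_eq_norm, dist_eq_norm, ← tmul_sub_right]
  exact norm_tmul_le _ _

/-- The integrand `h_Q(θᵗ z)^p`. -/
noncomputable def ker (Q : ConvexBody (Vec m)) (p : ℝ) (θ : Mat n m) (z : Vec n) : ℝ :=
  supp Q (tmul θ z) ^ p

section ker

variable {Q : ConvexBody (Vec m)} {p : ℝ}

theorem ker_nonneg (h0 : (0 : Vec m) ∈ interior (Q : Set (Vec m))) (θ : Mat n m) (z : Vec n) :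
    0 ≤ ker Q p θ z := Real.rpow_nonneg (supp_nonneg h0 _) _

theorem continuous_ker (hp : 0 ≤ p) :
    Continuous fun x : Mat n m × Vec n => ker Q p x.1 x.2 :=
  ((continuous_supp Q).comp continuous_tmul).rpow_const fun _ => Or.inr hp

theorem ker_smul_left (h0 : (0 : Vec m) ∈ interior (Q : Set (Vec m))) {a : ℝ} (ha : 0 < a)
    (θ : Mat n m) (z : Vec n) : ker Q p (a • θ) z = a ^ p * ker Q p θ z := by
  rw [ker, tmul_smul_left, supp_smul Q ha, Real.mul_rpow ha.le (supp_nonneg h0 _), ker]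

theorem ker_smul_right (h0 : (0 : Vec m) ∈ interior (Q : Set (Vec m))) {a : ℝ} (ha : 0 < a)
    (θ : Mat n m) (z : Vec n) : ker Q p θ (a • z) = a ^ p * ker Q p θ z := by
  rw [ker, tmul_smul_right, supp_smul Q ha, Real.mul_rpow ha.le (supp_nonneg h0 _), ker]

theorem ker_eq_zero (h0 : (0 : Vec m) ∈ interior (Q : Set (Vec m))) (hp : 0 < p)
    {θ : Mat n m} {z : Vec n} : ker Q p θ z = 0 ↔ tmul θ z = 0 := by
  rw [ker, Real.rpow_eq_zero (supp_nonneg h0 _) hp.ne', supp_eq_zero h0]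

theorem exists_ker_le (h0 : (0 : Vec m) ∈ interior (Q : Set (Vec m))) (hp : 0 ≤ p) :
    ∃ C, 0 < C ∧ ∀ (θ : Mat n m) (z : Vec n), ker Q p θ z ≤ C * (‖θ‖ ^ p * ‖z‖ ^ p) := by
  obtain ⟨C, hC0, hC⟩ := exists_supp_le_mul_norm Q
  refine ⟨C ^ p, by positivity, fun θ z => ?_⟩
  rw [← Real.mul_rpow (norm_nonneg _) (norm_nonneg _),
    ← Real.mul_rpow hC0.le (by positivity)]
  exact Real.rpow_le_rpow (supp_nonneg h0 _)
    ((hC _).trans (mul_le_mul_of_nonneg_left (norm_tmul_le _ _) hC0.le)) hp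

end ker

/-- A power with exponent greater than one of a nonnegative Lipschitz function is differentiable
as soon as the function is differentiable at the points where it does not vanish. -/
theorem hasFDerivAt_rpow_of_lipschitz {E : Type*} [NormedAddCommGroup E] [NormedSpace ℝ E]
    {u : E → ℝ} {C : NNReal} (hu0 : ∀ z, 0 ≤ u z) (hu : LipschitzWith C u)
    (hd : ∀ z, u z ≠ 0 → DifferentiableAt ℝ u z) {p : ℝ} (hp : 1 < p) (z : E) :
    HasFDerivAt (fun z => u z ^ p) ((p * u z ^ (p - 1)) • fderiv ℝ u z) z := by
  by_cases hz : u z = 0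
  -- Where `u` vanishes, `fderiv ℝ u z` may be a default value, but its coefficient is `0` since `p
  -- > 1`. The Lipschitz bound gives `u w ^ p = O(‖w - z‖ ^ p) = o(‖w - z‖)`.
  · rw [hz, Real.zero_rpow (by linarith), mul_zero, zero_smul]
    have hO : (fun w => u w ^ p - u z ^ p) =O[𝓝 z] fun w => ‖w - z‖ ^ p := by
      refine Asymptotics.IsBigO.of_bound ((C : ℝ) ^ p) (Eventually.of_forall fun w => ?_)
      rw [hz, Real.zero_rpow (by linarith), sub_zero, Real.norm_eq_abs, Real.norm_eq_abs,
        abs_of_nonneg (Real.rpow_nonneg (hu0 _) _), abs_of_nonneg (by positivity),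
        ← Real.mul_rpow C.coe_nonneg (norm_nonneg _)]
      refine Real.rpow_le_rpow (hu0 _) ?_ (by linarith)
      have := hu.dist_le_mul w z
      rwa [hz, dist_zero_right, Real.norm_eq_abs, abs_of_nonneg (hu0 _), dist_eq_norm] at this
    rw [hasFDerivAt_iff_isLittleO]
    simp only [zero_apply, sub_zero]
    refine hO.trans_isLittleO ?_
    have : (fun w : E => ‖w - z‖ ^ p) = fun w => ‖w - z‖ ^ (p - 1) * ‖w - z‖ := by
      ext w
      by_cases hw : ‖w - z‖ = 0
      · rw [hw, Real.zero_rpow (by linarith), mul_zero]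
      · rw [← Real.rpow_add_one hw, sub_add_cancel]
    rw [this]
    have h1 : (fun w : E => ‖w - z‖ ^ (p - 1)) =o[𝓝 z] fun _ => (1 : ℝ) := by
      rw [Asymptotics.isLittleO_one_iff]
      have : Continuous fun w : E => ‖w - z‖ ^ (p - 1) :=
        (by fun_prop : Continuous fun w : E => ‖w - z‖).rpow_const fun _ => Or.inr (by linarith)
      simpa [Real.zero_rpow (by linarith : p - 1 ≠ 0)] using this.tendsto z
    simpa using (h1.mul_isBigO (Asymptotics.isBigO_refl (fun w : E => ‖w - z‖) _)).trans_isBigO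
      (Asymptotics.isBigO_of_le _ fun w => by simp : (fun w : E => 1 * ‖w - z‖) =O[𝓝 z]
        fun w => w - z)
  · exact (hd z hz).hasFDerivAt.rpow_const (Or.inl hz)

variable {Q : ConvexBody (Vec m)} {p : ℝ}

theorem hasFDerivAt_ker (hQ : Admissible n Q) (hp : 1 < p) (θ : Mat n m) (z : Vec n) :
    HasFDerivAt (ker Q p θ)
      ((p * supp Q (tmul θ z) ^ (p - 1)) • fderiv ℝ (fun v => supp Q (tmul θ v)) z) z := by
  obtain ⟨C, -, hC⟩ := exists_lipschitz_supp_tmul (n := n) Q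
  refine hasFDerivAt_rpow_of_lipschitz (fun z => supp_nonneg hQ.1 _) (hC θ) (fun w hw => ?_) hp z
  have hopen : IsOpen {ξ : Vec n | tmul θ ξ ≠ 0} :=
    isOpen_ne_fun (continuous_tmul.comp (by fun_prop : Continuous fun ξ : Vec n => (θ, ξ)))
      continuous_const
  have hw' : w ∈ {ξ : Vec n | tmul θ ξ ≠ 0} := fun h => hw ((supp_eq_zero hQ.1).2 h)
  exact ((hQ.2 θ).differentiableOn (by norm_num)).differentiableAt (hopen.mem_nhds hw')

/-- The factor `h_Q(θᵗ z)^(p-1)` contributes `‖θ‖^(p-1) ‖z‖^(p-1)`, and the Lipschitz constant of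
`h_Q(θᵗ ·)` contributes the last power of `‖θ‖`. -/
theorem exists_norm_fderiv_ker_le (hQ : Admissible n Q) (hp : 1 < p) :
    ∃ C, 0 < C ∧ ∀ (θ : Mat n m) (z : Vec n),
      ‖fderiv ℝ (ker Q p θ) z‖ ≤ C * (‖θ‖ ^ p * ‖z‖ ^ (p - 1)) := by
  obtain ⟨C, hC0, hC⟩ := exists_lipschitz_supp_tmul (n := n) Q
  obtain ⟨D, hD0, hD⟩ := exists_ker_le (n := n) hQ.1 (p := p - 1) (by linarith)
  refine ⟨p * D * C, by positivity, fun θ z => ?_⟩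
  rw [(hasFDerivAt_ker hQ hp θ z).fderiv, norm_smul, Real.norm_eq_abs, abs_of_nonneg
    (mul_nonneg (by linarith) (Real.rpow_nonneg (supp_nonneg hQ.1 _) _))]
  have h1 := norm_fderiv_le_of_lipschitz ℝ (hC θ) (x₀ := z)
  have h2 := hD θ z
  rw [ker] at h2
  have h3 : ‖θ‖ ^ (p - 1) * ‖θ‖ = ‖θ‖ ^ p := by
    by_cases h : ‖θ‖ = 0
    · rw [h, Real.zero_rpow (by linarith), mul_zero, Real.zero_rpow (by linarith)]
    · rw [← Real.rpow_add_one h, sub_add_cancel]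
  push_cast at h1
  calc p * supp Q (tmul θ z) ^ (p - 1) * ‖fderiv ℝ (fun v => supp Q (tmul θ v)) z‖
      ≤ p * (D * (‖θ‖ ^ (p - 1) * ‖z‖ ^ (p - 1))) * (C * ‖θ‖) := by
        gcongr
    _ = p * D * C * ((‖θ‖ ^ (p - 1) * ‖θ‖) * ‖z‖ ^ (p - 1)) := by ring
    _ = _ := by rw [h3]

end support

/-! ### Polar coordinates and Hölder's inequality on the sphere -/

section polar

variable {E : Type*} [NormedAddCommGroup E]

theorem continuous_sphere_rpow {N : E → ℝ} (hN : Continuous N)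
    (hpos : ∀ x, x ≠ 0 → 0 < N x) (s : ℝ) :
    Continuous fun θ : Metric.sphere (0 : E) 1 => N θ ^ s :=
  (hN.comp continuous_subtype_val).rpow_const fun θ =>
    Or.inl (hpos _ (ne_zero_of_mem_unit_sphere θ)).ne'

variable [NormedSpace ℝ E] [FiniteDimensional ℝ E]

theorem exists_mul_norm_le_of_homogeneous [Nontrivial E] {N : E → ℝ} (hN : Continuous N)
    (hpos : ∀ x, x ≠ 0 → 0 < N x) (hom : ∀ a, 0 < a → ∀ x, N (a • x) = a * N x) :
    ∃ c, 0 < c ∧ ∀ x, x ≠ 0 → c * ‖x‖ ≤ N x := by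
  obtain ⟨y, hy, hmin⟩ := (isCompact_sphere (0 : E) 1).exists_isMinOn
    (NormedSpace.sphere_nonempty.2 zero_le_one) hN.continuousOn
  refine ⟨N y, hpos y (ne_zero_of_mem_unit_sphere ⟨y, hy⟩), fun x hx => ?_⟩
  have hx' : 0 < ‖x‖ := norm_pos_iff.2 hx
  have h1 := hmin (show ‖x‖⁻¹ • x ∈ Metric.sphere (0 : E) 1 by
    rw [mem_sphere_zero_iff_norm, norm_smul, norm_inv, norm_norm, inv_mul_cancel₀ hx'.ne'])
  rw [Set.mem_ofPred_eq, hom _ (by positivity)] at h1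
  rwa [mul_comm, ← le_inv_mul_iff₀ hx']

theorem isCompact_sublevel_of_homogeneous [Nontrivial E] {N : E → ℝ} (hN : Continuous N)
    (hpos : ∀ x, x ≠ 0 → 0 < N x) (hom : ∀ a, 0 < a → ∀ x, N (a • x) = a * N x) :
    IsCompact {x | N x ≤ 1} := by
  obtain ⟨c, hc, hcN⟩ := exists_mul_norm_le_of_homogeneous hN hpos hom
  refine Metric.isCompact_of_isClosed_isBounded (isClosed_le hN continuous_const)
    (isBounded_iff_forall_norm_le.2 ⟨c⁻¹, fun x hx => ?_⟩)
  by_cases h0 : x = 0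
  · simp [h0, hc.le]
  · rw [← div_one c, inv_div, le_div_iff₀' hc]
    exact (hcN x h0).trans hx

theorem integral_volumeIoiPow (k : ℕ) (f : ℝ → ℝ) :
    ∫ r : Set.Ioi (0 : ℝ), f r ∂Measure.volumeIoiPow k = ∫ r in Set.Ioi (0 : ℝ), r ^ k * f r := by
  simp only [Measure.volumeIoiPow, ENNReal.ofReal]
  rw [integral_withDensity_eq_integral_smul,
    integral_subtype_comap measurableSet_Ioi fun a ↦ Real.toNNReal (a ^ k) • f a,
    setIntegral_congr_fun measurableSet_Ioi fun x hx ↦ ?_]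
  · rw [NNReal.smul_def, Real.coe_toNNReal _ (pow_nonneg hx.out.le _), smul_eq_mul]
  · exact (measurable_subtype_coe.pow_const _).real_toNNReal

/-- The integral of a homogeneous function over the unit ball of a gauge, in polar coordinates. -/
theorem setIntegral_sublevel_eq_integral_sphere [Nontrivial E] [MeasurableSpace E] [BorelSpace E]
    (μ : Measure E) [μ.IsAddHaarMeasure] {F N : E → ℝ} {p : ℝ} (hp : 0 ≤ p)
    (hF : Continuous F) (hN : Continuous N) (hpos : ∀ x, x ≠ 0 → 0 < N x)
    (hom : ∀ a, 0 < a → ∀ x, N (a • x) = a * N x)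
    (homF : ∀ a, 0 < a → ∀ x, F (a • x) = a ^ p * F x) :
    ∫ x in {x | N x ≤ 1}, F x ∂μ = (Module.finrank ℝ E + p)⁻¹ *
      ∫ θ : Metric.sphere (0 : E) 1, F θ * N θ ^ (-(Module.finrank ℝ E + p)) ∂μ.toSphere := by
  have hK := isCompact_sublevel_of_homogeneous hN hpos hom
  set K : Set E := {x | N x ≤ 1}
  set d := Module.finrank ℝ E with hd
  have hd0 : 0 < d := Module.finrank_pos
  -- The integrand in coordinates `(θ, r)`; the origin, which these coordinates miss, is a null set.
  let g : Metric.sphere (0 : E) 1 × Set.Ioi (0 : ℝ) → ℝ := fun y => K.indicator F (y.2.1 • y.1.1)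
  have hg : ∀ x : ({0}ᶜ : Set E), g (homeomorphUnitSphereProd E x) = K.indicator F x.1 := by
    intro x
    have hx : ‖x.1‖ ≠ 0 := norm_ne_zero_iff.2 x.2
    simp [g, smul_smul, mul_inv_cancel₀ hx]
  have hint : Integrable (K.indicator F) μ :=
    (integrable_indicator_iff hK.measurableSet).2 (hF.continuousOn.integrableOn_compact hK)
  have hgint : Integrable g (μ.toSphere.prod (.volumeIoiPow (d - 1))) := by
    rw [← μ.measurePreserving_homeomorphUnitSphereProd.integrable_comp_emb
      (Homeomorph.measurableEmbedding _)]
    have : g ∘ homeomorphUnitSphereProd E = fun x : ({0}ᶜ : Set E) => K.indicator F x.1 :=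
      funext hg
    rw [this]
    have hemb : MeasurableEmbedding (Subtype.val : ({0}ᶜ : Set E) → E) :=
      .subtype_coe (measurableSet_singleton _).compl
    rw [← Function.comp_def (K.indicator F), ← hemb.integrable_map_iff, hemb.map_comap]
    exact hint.mono_measure Measure.restrict_le_self
  calc ∫ x in K, F x ∂μ = ∫ x, K.indicator F x ∂μ := (integral_indicator hK.measurableSet).symm
    _ = ∫ x : ({0}ᶜ : Set E), K.indicator F x.1 ∂(μ.comap (↑)) := by
      rw [integral_subtype_comap (measurableSet_singleton _).compl (K.indicator F),
        restrict_compl_singleton]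
    _ = ∫ y, g y ∂μ.toSphere.prod (.volumeIoiPow (d - 1)) := by
      rw [← μ.measurePreserving_homeomorphUnitSphereProd.integral_comp
        (Homeomorph.measurableEmbedding _)]
      simp only [hg]
    _ = ∫ θ, ∫ r, g (θ, r) ∂.volumeIoiPow (d - 1) ∂μ.toSphere := integral_prod _ hgint
    _ = ∫ θ : Metric.sphere (0 : E) 1, (d + p)⁻¹ * (F θ * N θ ^ (-(d + p))) ∂μ.toSphere := by
      refine integral_congr_ae (Eventually.of_forall fun θ => ?_)
      have hNθ : 0 < N θ := hpos _ (ne_zero_of_mem_unit_sphere θ)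
      simp only [g]
      rw [integral_volumeIoiPow (d - 1) fun r => K.indicator F (r • θ.1)]
      -- The ray through `θ` meets `K` for `r` in `(0, 1 / N θ]`, and there homogeneity turns the
      -- integrand into `F θ * r ^ (d + p - 1)`.
      have : ∀ r ∈ Set.Ioi (0 : ℝ), r ^ (d - 1) * K.indicator F (r • θ.1) =
          (Set.Ioc 0 (N θ)⁻¹).indicator (fun r => F θ * r ^ (d + p - 1)) r := by
        intro r (hr : 0 < r)
        have hiff : r • θ.1 ∈ K ↔ r ∈ Set.Ioc 0 (N θ)⁻¹ := by
          simp only [K, Set.mem_ofPred_eq, Set.mem_Ioc, hom r hr, hr, true_and]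
          rw [← one_div, le_div_iff₀ hNθ]
        by_cases h : r • θ.1 ∈ K
        · rw [Set.indicator_of_mem h, Set.indicator_of_mem (hiff.1 h), homF r hr,
            ← Real.rpow_natCast, Nat.cast_pred hd0,
            show (d : ℝ) + p - 1 = (d - 1) + p by ring, Real.rpow_add hr]
          ring
        · rw [Set.indicator_of_notMem h, Set.indicator_of_notMem (mt hiff.2 h), mul_zero]
      have hexp : (-1 : ℝ) < d + p - 1 := by
        have : (0 : ℝ) < d := by exact_mod_cast hd0
        linarith
      rw [setIntegral_congr_fun measurableSet_Ioi this, setIntegral_indicator measurableSet_Ioc,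
        Set.inter_eq_self_of_subset_right Set.Ioc_subset_Ioi_self, integral_const_mul,
        ← intervalIntegral.integral_of_le (by positivity), integral_rpow (Or.inl hexp),
        sub_add_cancel, Real.zero_rpow (by linarith), sub_zero, Real.inv_rpow hNθ.le,
        Real.rpow_neg hNθ.le]
      field_simp
    _ = _ := integral_const_mul _ _

theorem integral_sphere_rpow_pos [Nontrivial E] [MeasurableSpace E] [BorelSpace E]
    (μ : Measure E) [μ.IsAddHaarMeasure] {N : E → ℝ} (hN : Continuous N)
    (hpos : ∀ x, x ≠ 0 → 0 < N x) (s : ℝ) :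
    0 < ∫ θ : Metric.sphere (0 : E) 1, N θ ^ s ∂μ.toSphere := by
  have hc := continuous_sphere_rpow hN hpos s
  have hne : μ.toSphere ≠ 0 := μ.toSphere_ne_zero
  have hp : ∀ θ : Metric.sphere (0 : E) 1, 0 < N θ ^ s := fun θ =>
    Real.rpow_pos_of_pos (hpos _ (ne_zero_of_mem_unit_sphere θ)) _
  rw [integral_pos_iff_support_of_nonneg (fun θ => (hp θ).le)
    (hc.integrable_of_hasCompactSupport (HasCompactSupport.of_compactSpace _))]
  rw [show Function.support (fun θ : Metric.sphere (0 : E) 1 => N θ ^ s) = Set.univ from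
    Set.eq_univ_of_forall fun θ => (hp θ).ne']
  exact Measure.measure_univ_pos.2 hne

/-- The dual mixed volume inequality on the sphere. -/
theorem rpow_integral_sphere_le [Nontrivial E] [MeasurableSpace E] [BorelSpace E]
    (μ : Measure E) [μ.IsAddHaarMeasure] {N N' : E → ℝ} {d p : ℝ} (hd : 0 < d) (hp : 0 < p)
    (hN : Continuous N) (hpos : ∀ x, x ≠ 0 → 0 < N x)
    (hN' : Continuous N') (hpos' : ∀ x, x ≠ 0 → 0 < N' x) :
    (∫ θ : Metric.sphere (0 : E) 1, N θ ^ (-d) ∂μ.toSphere) ^ (p / d + 1) *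
      (∫ θ : Metric.sphere (0 : E) 1, N' θ ^ (-d) ∂μ.toSphere) ^ (-(p / d)) ≤
      ∫ θ : Metric.sphere (0 : E) 1, N' θ ^ p * N θ ^ (-(d + p)) ∂μ.toSphere := by
  -- Hölder is applied to `N^(-d) = (N'^s N^(-d)) * N'^(-s)` with `s = pd / (d + p)`, chosen so that
  -- the two norms contain `N'^p N^(-(d+p))` and `N'^(-d)`.
  have hconj : ((d + p) / d).HolderConjugate ((d + p) / p) := by
    rw [Real.holderConjugate_iff]
    refine ⟨by rw [lt_div_iff₀ hd]; linarith, by field_simp⟩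
  have hS : ∀ θ : Metric.sphere (0 : E) 1, 0 < N θ := fun θ =>
    hpos _ (ne_zero_of_mem_unit_sphere θ)
  have hS' : ∀ θ : Metric.sphere (0 : E) 1, 0 < N' θ := fun θ =>
    hpos' _ (ne_zero_of_mem_unit_sphere θ)
  have c1 : Continuous fun θ : Metric.sphere (0 : E) 1 => N' θ ^ (p * d / (d + p)) * N θ ^ (-d) :=
    (continuous_sphere_rpow hN' hpos' _).mul (continuous_sphere_rpow hN hpos _)
  have c2 : Continuous fun θ : Metric.sphere (0 : E) 1 => N' θ ^ (-(p * d / (d + p))) :=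
    continuous_sphere_rpow hN' hpos' _
  have H := integral_mul_le_Lp_mul_Lq_of_nonneg (μ := μ.toSphere) hconj
    (Eventually.of_forall fun θ => mul_nonneg (Real.rpow_nonneg (hS' θ).le _)
      (Real.rpow_nonneg (hS θ).le _))
    (Eventually.of_forall fun θ => Real.rpow_nonneg (hS' θ).le _)
    (c1.memLp_of_hasCompactSupport (HasCompactSupport.of_compactSpace _))
    (c2.memLp_of_hasCompactSupport (HasCompactSupport.of_compactSpace _))
  have e0 : ∀ θ : Metric.sphere (0 : E) 1,
      N' θ ^ (p * d / (d + p)) * N θ ^ (-d) * N' θ ^ (-(p * d / (d + p))) = N θ ^ (-d) := by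
    intro θ
    rw [mul_right_comm, ← Real.rpow_add (hS' θ), add_neg_cancel, Real.rpow_zero, one_mul]
  have e1 : ∀ θ : Metric.sphere (0 : E) 1,
      (N' θ ^ (p * d / (d + p)) * N θ ^ (-d)) ^ ((d + p) / d) = N' θ ^ p * N θ ^ (-(d + p)) := by
    intro θ
    rw [Real.mul_rpow (Real.rpow_nonneg (hS' θ).le _) (Real.rpow_nonneg (hS θ).le _),
      ← Real.rpow_mul (hS' θ).le, ← Real.rpow_mul (hS θ).le]
    congr 2 <;> field_simp
  have e2 : ∀ θ : Metric.sphere (0 : E) 1,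
      (N' θ ^ (-(p * d / (d + p)))) ^ ((d + p) / p) = N' θ ^ (-d) := by
    intro θ
    rw [← Real.rpow_mul (hS' θ).le]
    congr 1; field_simp
  simp only [e0, e1, e2] at H
  have hI := integral_sphere_rpow_pos μ hN hpos (-d)
  have hI' := integral_sphere_rpow_pos μ hN' hpos' (-d)
  have hM : 0 ≤ ∫ θ : Metric.sphere (0 : E) 1, N' θ ^ p * N θ ^ (-(d + p)) ∂μ.toSphere :=
    integral_nonneg fun θ => mul_nonneg (Real.rpow_nonneg (hS' θ).le _)
      (Real.rpow_nonneg (hS θ).le _)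
  generalize (∫ θ : Metric.sphere (0 : E) 1, N θ ^ (-d) ∂μ.toSphere) = I at *
  generalize (∫ θ : Metric.sphere (0 : E) 1, N' θ ^ (-d) ∂μ.toSphere) = I' at *
  generalize (∫ θ : Metric.sphere (0 : E) 1, N' θ ^ p * N θ ^ (-(d + p)) ∂μ.toSphere) = M at *
  -- The power `p / d + 1 = (d + p) / d` brings the mixed integral to exponent one.
  have H2 := Real.rpow_le_rpow hI.le H (show 0 ≤ p / d + 1 by positivity)
  rw [Real.mul_rpow (by positivity) (by positivity), ← Real.rpow_mul hM, ← Real.rpow_mul hI'.le,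
    show 1 / ((d + p) / d) * (p / d + 1) = 1 by field_simp; ring,
    show 1 / ((d + p) / p) * (p / d + 1) = p / d by field_simp; ring, Real.rpow_one] at H2
  rwa [Real.rpow_neg hI'.le, ← div_eq_mul_inv, div_le_iff₀ (by positivity)]

end polar

/-! ### Differentiating integral functionals of `p`-growth -/

theorem integrable_norm_rpow_of_memLp {α E : Type*} [MeasurableSpace α] [NormedAddCommGroup E]
    {μ : Measure α} {p : ℝ} (hp : 0 < p) {G : α → E} (hG : MemLp G (ENNReal.ofReal p) μ) :
    Integrable (fun x => ‖G x‖ ^ p) μ := by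
  have := hG.integrable_norm_rpow (by simpa using hp) ENNReal.ofReal_ne_top
  rwa [ENNReal.toReal_ofReal hp.le] at this

/-- Differentiation of an integral functional with `p`-growth along a line. -/
theorem hasDerivAt_integral_comp_add_smul {α E : Type*} [MeasurableSpace α]
    [NormedAddCommGroup E] [NormedSpace ℝ E] [FiniteDimensional ℝ E] [MeasurableSpace E]
    [BorelSpace E] {μ : Measure α} {p : ℝ} (hp : 1 < p) {H : E → ℝ} {C : ℝ} (hC : 0 ≤ C)
    (hd : Differentiable ℝ H) (hH : ∀ z, |H z| ≤ C * ‖z‖ ^ p)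
    (hDH : ∀ z, ‖fderiv ℝ H z‖ ≤ C * ‖z‖ ^ (p - 1)) {G G' : α → E}
    (hG : MemLp G (ENNReal.ofReal p) μ) (hG' : MemLp G' (ENNReal.ofReal p) μ) :
    Integrable (fun x => fderiv ℝ H (G x) (G' x)) μ ∧
      HasDerivAt (fun t : ℝ => ∫ x, H (G x + t • G' x) ∂μ) (∫ x, fderiv ℝ H (G x) (G' x) ∂μ) 0 := by
  have hp0 : 0 < p := by linarith
  have hmeas : ∀ t : ℝ, AEStronglyMeasurable (fun x => G x + t • G' x) μ := fun t =>
    hG.1.add (hG'.1.const_smul t)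
  -- The dominating function for the derivative in `t`, valid for `|t| < 1`.
  have hsum : Integrable (fun x => C * (‖G x‖ + ‖G' x‖) ^ p) μ := by
    have h := integrable_norm_rpow_of_memLp hp0 (hG.norm.add hG'.norm)
    refine (h.congr (Eventually.of_forall fun x => ?_)).const_mul C
    simp only [Pi.add_apply]
    rw [Real.norm_of_nonneg (by positivity)]
  have hDmeas : AEStronglyMeasurable (fun x => fderiv ℝ H (G x)) μ :=
    ((measurable_fderiv ℝ H).comp_aemeasurable hG.1.aemeasurable).aestronglyMeasurable
  have key := hasDerivAt_integral_of_dominated_loc_of_deriv_le (μ := μ) (x₀ := (0 : ℝ))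
    (s := Metric.ball 0 1) (F := fun t x => H (G x + t • G' x))
    (F' := fun t x => fderiv ℝ H (G x + t • G' x) (G' x))
    (bound := fun x => C * (‖G x‖ + ‖G' x‖) ^ p)
    (Metric.ball_mem_nhds _ one_pos)
    (Eventually.of_forall fun t => hd.continuous.comp_aestronglyMeasurable (hmeas t))
    ?_ ?_ ?_ hsum ?_
  · simpa using key
  · refine ((integrable_norm_rpow_of_memLp hp0 hG).const_mul C).mono' ?_ ?_
    · exact hd.continuous.comp_aestronglyMeasurable (hmeas 0)
    · exact Eventually.of_forall fun x => by simpa using hH (G x)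
  · have := isBoundedBilinearMap_apply.continuous.comp_aestronglyMeasurable
      (hDmeas.prodMk hG'.1)
    simpa using this
  · refine Eventually.of_forall fun x t ht => ?_
    rw [mem_ball_zero_iff, Real.norm_eq_abs] at ht
    have h1 : ‖G x + t • G' x‖ ≤ ‖G x‖ + ‖G' x‖ := by
      refine (norm_add_le _ _).trans ?_
      rw [norm_smul, Real.norm_eq_abs]
      nlinarith [norm_nonneg (G' x)]
    have h2 : (‖G x‖ + ‖G' x‖) ^ (p - 1) * (‖G x‖ + ‖G' x‖) = (‖G x‖ + ‖G' x‖) ^ p := by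
      by_cases h : ‖G x‖ + ‖G' x‖ = 0
      · rw [h, Real.zero_rpow (by linarith), mul_zero, Real.zero_rpow (by linarith)]
      · rw [← Real.rpow_add_one h, sub_add_cancel]
    calc ‖fderiv ℝ H (G x + t • G' x) (G' x)‖
        ≤ ‖fderiv ℝ H (G x + t • G' x)‖ * ‖G' x‖ := ContinuousLinearMap.le_opNorm _ _
      _ ≤ C * (‖G x‖ + ‖G' x‖) ^ (p - 1) * (‖G x‖ + ‖G' x‖) := by
        refine mul_le_mul ((hDH _).trans ?_) (by linarith [norm_nonneg (G x)]) (norm_nonneg _)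
          (by positivity)
        refine mul_le_mul_of_nonneg_left ?_ hC
        exact Real.rpow_le_rpow (norm_nonneg _) h1 (by linarith)
      _ = _ := by rw [mul_assoc, h2]
  · refine Eventually.of_forall fun x t _ => ?_
    have h1 : HasDerivAt (fun t : ℝ => G x + t • G' x) (G' x) t := by
      simpa using ((hasDerivAt_id t).smul_const (G' x)).const_add (G x)
    exact (hd _).hasFDerivAt.comp_hasDerivAt t h1

/-- The matrices that annihilate the field `G` almost everywhere are zero. -/
def Nondegenerate {n : ℕ} (m : ℕ) (G : Vec n → Vec n) : Prop :=
  ∀ θ : Mat n m, (∀ᵐ x, tmul θ (G x) = 0) → θ = 0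

/-! ### The gauge `‖θ‖_f` of the polar projection body -/

section gauge

variable {n m : ℕ} {Q : ConvexBody (Vec m)} {p : ℝ} {G : Vec n → Vec n}

theorem integrable_ker (h0 : (0 : Vec m) ∈ interior (Q : Set (Vec m))) (hp : 0 < p)
    (hG : MemLp G (ENNReal.ofReal p) volume) (θ : Mat n m) :
    Integrable fun x => ker Q p θ (G x) := by
  obtain ⟨C, hC0, hC⟩ := exists_ker_le (n := n) h0 hp.le
  refine ((integrable_norm_rpow_of_memLp hp hG).const_mul (C * ‖θ‖ ^ p)).mono' ?_ ?_
  · exact ((continuous_ker hp.le).comp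
      (Continuous.prodMk_right θ)).comp_aestronglyMeasurable hG.1
  · refine Eventually.of_forall fun x => ?_
    rw [Real.norm_of_nonneg (ker_nonneg h0 _ _), mul_assoc]
    exact hC θ _

theorem continuous_integral_ker (h0 : (0 : Vec m) ∈ interior (Q : Set (Vec m))) (hp : 0 < p)
    (hG : MemLp G (ENNReal.ofReal p) volume) :
    Continuous fun θ : Mat n m => ∫ x, ker Q p θ (G x) := by
  obtain ⟨C, hC0, hC⟩ := exists_ker_le (n := n) h0 hp.le
  refine continuous_iff_continuousAt.2 fun θ₀ => continuousAt_of_dominated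
    (bound := fun x => C * (‖θ₀‖ + 1) ^ p * ‖G x‖ ^ p)
    (Eventually.of_forall fun θ => (integrable_ker h0 hp hG θ).1) ?_
    ((integrable_norm_rpow_of_memLp hp hG).const_mul _)
    (Eventually.of_forall fun x => ?_)
  · filter_upwards [Metric.ball_mem_nhds θ₀ one_pos] with θ hθ
    refine Eventually.of_forall fun x => ?_
    rw [Real.norm_of_nonneg (ker_nonneg h0 _ _), mul_assoc]
    refine (hC θ _).trans ?_
    have : ‖θ‖ ≤ ‖θ₀‖ + 1 := by
      have := norm_sub_norm_le θ θ₀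
      rw [mem_ball_iff_norm] at hθ
      linarith
    gcongr
  · exact ((continuous_ker hp.le).comp (Continuous.prodMk_left (G x))).continuousAt

theorem integral_ker_nonneg (h0 : (0 : Vec m) ∈ interior (Q : Set (Vec m))) (θ : Mat n m) :
    0 ≤ ∫ x, ker Q p θ (G x) := integral_nonneg fun _ => ker_nonneg h0 _ _

theorem integral_ker_smul (h0 : (0 : Vec m) ∈ interior (Q : Set (Vec m))) {a : ℝ} (ha : 0 < a)
    (θ : Mat n m) : ∫ x, ker Q p (a • θ) (G x) = a ^ p * ∫ x, ker Q p θ (G x) := by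
  simp only [ker_smul_left h0 ha, integral_const_mul]

theorem fieldGauge_rpow (h0 : (0 : Vec m) ∈ interior (Q : Set (Vec m))) (hp : 0 < p)
    (θ : Mat n m) : fieldGauge Q p G θ ^ p = ∫ x, ker Q p θ (G x) := by
  change ((∫ x, ker Q p θ (G x)) ^ (1 / p)) ^ p = _
  rw [← Real.rpow_mul (integral_ker_nonneg h0 θ), one_div_mul_cancel hp.ne', Real.rpow_one]

theorem continuous_fieldGauge (h0 : (0 : Vec m) ∈ interior (Q : Set (Vec m))) (hp : 0 < p)
    (hG : MemLp G (ENNReal.ofReal p) volume) : Continuous (fieldGauge Q p G : Mat n m → ℝ) :=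
  (continuous_integral_ker h0 hp hG).rpow_const fun _ => Or.inr (by positivity)

theorem fieldGauge_smul (h0 : (0 : Vec m) ∈ interior (Q : Set (Vec m))) (hp : 0 < p)
    (a : ℝ) (ha : 0 < a) (θ : Mat n m) : fieldGauge Q p G (a • θ) = a * fieldGauge Q p G θ := by
  change (∫ x, ker Q p (a • θ) (G x)) ^ (1 / p) = a * (∫ x, ker Q p θ (G x)) ^ (1 / p)
  rw [integral_ker_smul h0 ha, Real.mul_rpow (by positivity) (integral_ker_nonneg h0 θ),
    ← Real.rpow_mul ha.le, mul_one_div_cancel hp.ne', Real.rpow_one]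

theorem fieldGauge_nonneg (h0 : (0 : Vec m) ∈ interior (Q : Set (Vec m))) (θ : Mat n m) :
    0 ≤ fieldGauge Q p G θ := Real.rpow_nonneg (integral_ker_nonneg h0 θ) _

theorem fieldGauge_pos (h0 : (0 : Vec m) ∈ interior (Q : Set (Vec m))) (hp : 0 < p)
    (hG : MemLp G (ENNReal.ofReal p) volume) (hnd : Nondegenerate m G) (θ : Mat n m)
    (hθ : θ ≠ 0) : 0 < fieldGauge Q p G θ := by
  refine Real.rpow_pos_of_pos ((integral_ker_nonneg h0 θ).lt_of_ne' fun h => hθ (hnd θ ?_)) _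
  have := (integral_eq_zero_iff_of_nonneg (fun x => ker_nonneg h0 _ _)
    (integrable_ker h0 hp hG θ)).1 h
  filter_upwards [this] with x hx
  exact (ker_eq_zero h0 hp).1 hx

end gauge

/-! ### Comparison of the affine energy with the frozen functional -/

section energy

variable {n m : ℕ} {Q : ConvexBody (Vec m)} {p : ℝ} {G G' : Vec n → Vec n}

theorem finrank_mat (n m : ℕ) : (Module.finrank ℝ (Mat n m) : ℝ) = n * m := by
  simp [finrank_euclideanSpace]

theorem nontrivial_mat (hn : 1 ≤ n) (hm : 1 ≤ m) : Nontrivial (Mat n m) := by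
  have : Nonempty (Fin n × Fin m) := ⟨(⟨0, hn⟩, ⟨0, hm⟩)⟩
  infer_instance

/-- The normalization of the `p`-th power of the support function of `L_{Q,p,f}`. -/
noncomputable def coef (Q : ConvexBody (Vec m)) (p : ℝ) (G : Vec n → Vec n) : ℝ :=
  ((m : ℝ) / (((n : ℝ) * m + p) * omega n))⁻¹ *
    (volume.real (ballPolarProj n Q p) / volume.real (polarProj Q p G)) ^ (p / ((n : ℝ) * m)) *
    (volume.real (polarProj Q p G))⁻¹

/-- The `p`-th power of the support function of `L_{Q,p,f}`. -/
noncomputable def suppLPow (Q : ConvexBody (Vec m)) (p : ℝ) (G : Vec n → Vec n) (z : Vec n) : ℝ :=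
  coef Q p G * ∫ θ in polarProj Q p G, ker Q p θ z

theorem omega_nonneg (n : ℕ) : 0 ≤ omega n := measureReal_nonneg

theorem coef_nonneg (hp : 0 < p) : 0 ≤ coef Q p G := by
  have := omega_nonneg n
  unfold coef
  positivity

theorem integral_ker_polarProj_nonneg (h0 : (0 : Vec m) ∈ interior (Q : Set (Vec m)))
    (z : Vec n) : 0 ≤ ∫ θ in polarProj Q p G, ker Q p θ z :=
  integral_nonneg fun _ => ker_nonneg h0 _ _

theorem suppL_nonneg (h0 : (0 : Vec m) ∈ interior (Q : Set (Vec m))) (hp : 0 < p) (z : Vec n) :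
    0 ≤ suppL Q p G z := by
  have := omega_nonneg n
  have h1 : 0 ≤ centroidSupp Q p (polarProj Q p G) z := Real.rpow_nonneg
    (mul_nonneg (inv_nonneg.2 measureReal_nonneg) (integral_ker_polarProj_nonneg h0 z)) _
  unfold suppL
  positivity

theorem suppL_rpow (h0 : (0 : Vec m) ∈ interior (Q : Set (Vec m))) (hp : 0 < p) (z : Vec n) :
    suppL Q p G z ^ p = suppLPow Q p G z := by
  have ho := omega_nonneg n
  have h1 : 0 ≤ (volume.real (polarProj Q p G))⁻¹ * ∫ θ in polarProj Q p G, supp Q (tmul θ z) ^ p :=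
    mul_nonneg (inv_nonneg.2 measureReal_nonneg) (integral_ker_polarProj_nonneg h0 z)
  have h2 : 0 ≤ (m : ℝ) / (((n : ℝ) * m + p) * omega n) := by positivity
  have h3 : 0 ≤ volume.real (ballPolarProj n Q p) / volume.real (polarProj Q p G) := by positivity
  rw [suppL, centroidSupp, Real.mul_rpow (by positivity) (by positivity),
    Real.mul_rpow (by positivity) (by positivity), ← Real.rpow_mul h2, ← Real.rpow_mul h3,
    ← Real.rpow_mul h1, one_div_mul_cancel hp.ne', Real.rpow_one, neg_mul,
    one_div_mul_cancel hp.ne', Real.rpow_neg_one, one_div_mul_eq_div, suppLPow, coef]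
  simp only [ker]
  ring

theorem isCompact_polarProj (hn : 1 ≤ n) (hm : 1 ≤ m)
    (h0 : (0 : Vec m) ∈ interior (Q : Set (Vec m))) (hp : 0 < p)
    (hG : MemLp G (ENNReal.ofReal p) volume) (hnd : Nondegenerate m G) :
    IsCompact (polarProj Q p G) :=
  have := nontrivial_mat hn hm
  isCompact_sublevel_of_homogeneous (continuous_fieldGauge h0 hp hG)
    (fieldGauge_pos h0 hp hG hnd) (fieldGauge_smul h0 hp)

theorem setIntegral_polarProj (hn : 1 ≤ n) (hm : 1 ≤ m)
    (h0 : (0 : Vec m) ∈ interior (Q : Set (Vec m))) (hp : 0 < p)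
    (hG : MemLp G (ENNReal.ofReal p) volume) (hnd : Nondegenerate m G)
    {F : Mat n m → ℝ} {s : ℝ} (hs : 0 ≤ s) (hF : Continuous F)
    (homF : ∀ a, 0 < a → ∀ x, F (a • x) = a ^ s * F x) :
    ∫ x in polarProj Q p G, F x = ((n : ℝ) * m + s)⁻¹ * ∫ θ : Metric.sphere (0 : Mat n m) 1,
      F θ * fieldGauge Q p G θ ^ (-((n : ℝ) * m + s)) ∂(volume : Measure (Mat n m)).toSphere := by
  have := nontrivial_mat hn hm
  have := setIntegral_sublevel_eq_integral_sphere volume hs hF (continuous_fieldGauge h0 hp hG)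
    (fieldGauge_pos h0 hp hG hnd) (fieldGauge_smul h0 hp) homF
  rwa [finrank_mat] at this

/-- `∫_{S} ‖θ‖_f^{-nm} dθ`. -/
noncomputable def sphereInt (Q : ConvexBody (Vec m)) (p : ℝ) (G : Vec n → Vec n) : ℝ :=
  ∫ θ : Metric.sphere (0 : Mat n m) 1, fieldGauge Q p G θ ^ (-((n : ℝ) * m))
      ∂(volume : Measure (Mat n m)).toSphere

theorem sphereInt_pos (hn : 1 ≤ n) (hm : 1 ≤ m)
    (h0 : (0 : Vec m) ∈ interior (Q : Set (Vec m))) (hp : 0 < p)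
    (hG : MemLp G (ENNReal.ofReal p) volume) (hnd : Nondegenerate m G) : 0 < sphereInt Q p G :=
  have := nontrivial_mat hn hm
  integral_sphere_rpow_pos volume (continuous_fieldGauge h0 hp hG)
    (fieldGauge_pos h0 hp hG hnd) _

theorem volume_polarProj (hn : 1 ≤ n) (hm : 1 ≤ m)
    (h0 : (0 : Vec m) ∈ interior (Q : Set (Vec m))) (hp : 0 < p)
    (hG : MemLp G (ENNReal.ofReal p) volume) (hnd : Nondegenerate m G) :
    volume.real (polarProj Q p G) = ((n : ℝ) * m)⁻¹ * sphereInt Q p G := by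
  have := setIntegral_polarProj hn hm h0 hp hG hnd (F := fun _ => 1) le_rfl continuous_const
    (fun a _ x => by simp)
  simpa [sphereInt] using this

theorem energy_nonneg (h0 : (0 : Vec m) ∈ interior (Q : Set (Vec m))) : 0 ≤ energy Q p G := by
  have := omega_nonneg n
  refine mul_nonneg ?_ (Real.rpow_nonneg (integral_nonneg fun θ =>
    Real.rpow_nonneg (fieldGauge_nonneg h0 _) _) _)
  unfold dConst
  positivity

theorem energy_rpow (h0 : (0 : Vec m) ∈ interior (Q : Set (Vec m))) (hp : 0 < p) :
    energy Q p G ^ p = n * omega n *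
      ((n : ℝ) * m * volume.real (ballPolarProj n Q p)) ^ (p / ((n : ℝ) * m)) *
      sphereInt Q p G ^ (-(p / ((n : ℝ) * m))) := by
  have ho := omega_nonneg n
  have h1 : 0 ≤ sphereInt Q p G := integral_nonneg fun θ =>
    Real.rpow_nonneg (fieldGauge_nonneg h0 _) _
  have h2 : 0 ≤ (n : ℝ) * m * volume.real (ballPolarProj n Q p) := by positivity
  have h3 : 0 ≤ (n : ℝ) * omega n := by positivity
  change (dConst n Q p * sphereInt Q p G ^ (-(1 / ((n : ℝ) * m)))) ^ p = _
  rw [dConst, Real.mul_rpow (by positivity) (by positivity),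
    Real.mul_rpow (by positivity) (by positivity), ← Real.rpow_mul h2, ← Real.rpow_mul h3,
    ← Real.rpow_mul h1, one_div_mul_cancel hp.ne', Real.rpow_one, neg_mul, one_div_mul_eq_div]

/-- Pairing of the gauges of two fields. -/
noncomputable def sphereMixed (Q : ConvexBody (Vec m)) (p : ℝ) (G G' : Vec n → Vec n) : ℝ :=
  ∫ θ : Metric.sphere (0 : Mat n m) 1, fieldGauge Q p G' θ ^ p *
    fieldGauge Q p G θ ^ (-((n : ℝ) * m + p)) ∂(volume : Measure (Mat n m)).toSphere

/-- The normalization of `L` is made for this identity: `(nm + p)⁻¹` from the radial integral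
cancels against `coef`, and `|Π°f| = (nm)⁻¹ ∫ ‖θ‖_f^(-nm)` leaves exactly the constant that appears
in `E^p`. -/
theorem coef_mul_setIntegral (hn : 1 ≤ n) (hm : 1 ≤ m)
    (h0 : (0 : Vec m) ∈ interior (Q : Set (Vec m))) (hp : 0 < p)
    (hG : MemLp G (ENNReal.ofReal p) volume) (hnd : Nondegenerate m G)
    (hG' : MemLp G' (ENNReal.ofReal p) volume) :
    coef Q p G * ∫ θ in polarProj Q p G, ∫ x, ker Q p θ (G' x) = n * omega n *
      ((n : ℝ) * m * volume.real (ballPolarProj n Q p)) ^ (p / ((n : ℝ) * m)) *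
      sphereInt Q p G ^ (-(p / ((n : ℝ) * m) + 1)) * sphereMixed Q p G G' := by
  have hI := sphereInt_pos hn hm h0 hp hG hnd
  have hn' : (0 : ℝ) < n := by exact_mod_cast hn
  have hm' : (0 : ℝ) < m := by exact_mod_cast hm
  rw [setIntegral_polarProj hn hm h0 hp hG hnd hp.le (continuous_integral_ker h0 hp hG')
    (fun a ha x => integral_ker_smul h0 ha x)]
  simp only [← fieldGauge_rpow h0 hp]
  change coef Q p G * (((n : ℝ) * m + p)⁻¹ * sphereMixed Q p G G') = _
  rw [coef, volume_polarProj hn hm h0 hp hG hnd,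
    show volume.real (ballPolarProj n Q p) / (((n : ℝ) * m)⁻¹ * sphereInt Q p G) =
      (n : ℝ) * m * volume.real (ballPolarProj n Q p) * (sphereInt Q p G)⁻¹ by field_simp,
    Real.mul_rpow (by positivity) (by positivity), Real.inv_rpow hI.le, ← Real.rpow_neg hI.le,
    neg_add, Real.rpow_add hI, Real.rpow_neg_one]
  field_simp

/-- The energy of any field is at most the integral of the `p`-th power of the support function
of the body attached to another field. -/
theorem energy_rpow_le (hn : 1 ≤ n) (hm : 1 ≤ m)
    (h0 : (0 : Vec m) ∈ interior (Q : Set (Vec m))) (hp : 0 < p)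
    (hG : MemLp G (ENNReal.ofReal p) volume) (hnd : Nondegenerate m G)
    (hG' : MemLp G' (ENNReal.ofReal p) volume) (hnd' : Nondegenerate m G') :
    energy Q p G' ^ p ≤ coef Q p G * ∫ θ in polarProj Q p G, ∫ x, ker Q p θ (G' x) := by
  have := nontrivial_mat hn hm
  have hd : (0 : ℝ) < n * m := by exact_mod_cast Nat.mul_pos hn hm
  have hI := sphereInt_pos hn hm h0 hp hG hnd
  have hI' := sphereInt_pos hn hm h0 hp hG' hnd'
  have ho := omega_nonneg n
  -- The dual mixed volume inequality, with `G'` carrying the exponent `p` and `G` the exponent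
  -- `-(nm + p)`.
  have key := rpow_integral_sphere_le volume hd hp (continuous_fieldGauge h0 hp hG)
    (fieldGauge_pos h0 hp hG hnd) (continuous_fieldGauge h0 hp hG')
    (fieldGauge_pos h0 hp hG' hnd')
  change sphereInt Q p G ^ (p / ((n : ℝ) * m) + 1) * sphereInt Q p G' ^ (-(p / ((n : ℝ) * m)))
    ≤ sphereMixed Q p G G' at key
  rw [coef_mul_setIntegral hn hm h0 hp hG hnd hG', energy_rpow h0 hp, mul_assoc _ (_ ^ _)
    (sphereMixed Q p G G')]
  refine mul_le_mul_of_nonneg_left ?_ (by positivity)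
  rwa [Real.rpow_neg hI.le, ← div_eq_inv_mul, le_div_iff₀ (by positivity), mul_comm]

/-- For equal fields the exponents `p` and `-(nm + p)` add up to `-nm`, so the mixed integral
collapses to `sphereInt` and no Hölder loss occurs. -/
theorem energy_rpow_eq (hn : 1 ≤ n) (hm : 1 ≤ m)
    (h0 : (0 : Vec m) ∈ interior (Q : Set (Vec m))) (hp : 0 < p)
    (hG : MemLp G (ENNReal.ofReal p) volume) (hnd : Nondegenerate m G) :
    energy Q p G ^ p = coef Q p G * ∫ θ in polarProj Q p G, ∫ x, ker Q p θ (G x) := by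
  have hI := sphereInt_pos hn hm h0 hp hG hnd
  have hM : sphereMixed Q p G G = sphereInt Q p G := by
    refine integral_congr_ae (Eventually.of_forall fun θ => ?_)
    have hpos := fieldGauge_pos h0 hp hG hnd θ (ne_zero_of_mem_unit_sphere θ)
    simp only
    rw [← Real.rpow_add hpos]
    congr 1; ring
  rw [coef_mul_setIntegral hn hm h0 hp hG hnd hG, energy_rpow h0 hp, hM, neg_add,
    Real.rpow_add hI, Real.rpow_neg_one]
  field_simp

/-- Fubini; the kernel is dominated by a multiple of `‖θ‖^p ‖G' x‖^p`, which is integrable because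
the polar body is compact. -/
theorem integral_suppLPow (hn : 1 ≤ n) (hm : 1 ≤ m)
    (h0 : (0 : Vec m) ∈ interior (Q : Set (Vec m))) (hp : 0 < p)
    (hG : MemLp G (ENNReal.ofReal p) volume) (hnd : Nondegenerate m G)
    (hG' : MemLp G' (ENNReal.ofReal p) volume) :
    ∫ x, suppLPow Q p G (G' x) =
      coef Q p G * ∫ θ in polarProj Q p G, ∫ x, ker Q p θ (G' x) := by
  have hK := isCompact_polarProj hn hm h0 hp hG hnd
  obtain ⟨C, hC0, hC⟩ := exists_ker_le (n := n) h0 hp.le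
  simp only [suppLPow, integral_const_mul]
  congr 1
  have hi1 : Integrable (fun θ : Mat n m => ‖θ‖ ^ p) (volume.restrict (polarProj Q p G)) :=
    (Continuous.continuousOn (continuous_norm.rpow_const fun _ =>
      Or.inr hp.le)).integrableOn_compact hK
  have hm : AEStronglyMeasurable (fun y : Vec n × Mat n m => (y.2, G' y.1))
      (volume.prod (volume.restrict (polarProj Q p G))) :=
    measurable_snd.aestronglyMeasurable.prodMk hG'.1.comp_fst
  have hm' := Continuous.comp_aestronglyMeasurable (continuous_ker (n := n) (Q := Q) hp.le) hm
  have hint : Integrable (fun y : Vec n × Mat n m => ker Q p y.2 (G' y.1))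
      (volume.prod (volume.restrict (polarProj Q p G))) := by
    refine (((integrable_norm_rpow_of_memLp hp hG').mul_prod hi1).const_mul C).mono' hm'
      (Eventually.of_forall fun y => ?_)
    rw [Real.norm_of_nonneg (ker_nonneg h0 _ _), mul_comm (‖G' y.1‖ ^ p)]
    exact hC _ _
  exact integral_integral_swap (f := fun x θ => ker Q p θ (G' x)) hint

end energy

/-! ### Differentiability of `h_L ^ p` and the flux -/

section suppLPow

variable {n m : ℕ} {Q : ConvexBody (Vec m)} {p : ℝ} {G : Vec n → Vec n}

theorem suppLPow_nonneg (h0 : (0 : Vec m) ∈ interior (Q : Set (Vec m))) (hp : 0 < p)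
    (z : Vec n) : 0 ≤ suppLPow Q p G z := by
  rw [← suppL_rpow h0 hp]
  exact Real.rpow_nonneg (suppL_nonneg h0 hp z) _

theorem suppLPow_smul (h0 : (0 : Vec m) ∈ interior (Q : Set (Vec m))) {a : ℝ} (ha : 0 < a)
    (z : Vec n) : suppLPow Q p G (a • z) = a ^ p * suppLPow Q p G z := by
  simp only [suppLPow, ker_smul_right h0 ha, integral_const_mul]
  ring

theorem measurable_fderiv_ker (hp : 0 ≤ p) (z : Vec n) :
    Measurable fun θ : Mat n m => fderiv ℝ (ker Q p θ) z := by
  have h : Measurable fun x : Mat n m × Vec n => fderiv ℝ (ker Q p x.1) x.2 :=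
    measurable_fderiv_with_param ℝ (continuous_ker hp)
  have := h.comp (measurable_prodMk_right (y := z))
  exact this

theorem continuous_ker_left (hp : 0 ≤ p) (w : Vec n) :
    Continuous fun θ : Mat n m => ker Q p θ w := by
  have h : Continuous fun x : Mat n m × Vec n => ker Q p x.1 x.2 := continuous_ker hp
  have := h.comp (Continuous.prodMk_left w)
  exact this

theorem hasFDerivAt_setIntegral_ker (hQ : Admissible n Q) (hp : 1 < p) {K : Set (Mat n m)}
    (hK : IsCompact K) (z : Vec n) :
    HasFDerivAt (fun z => ∫ θ in K, ker Q p θ z) (∫ θ in K, fderiv ℝ (ker Q p θ) z) z := by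
  have hp0 : 0 < p := by linarith
  obtain ⟨C, hC0, hC⟩ := exists_norm_fderiv_ker_le hQ hp
  have hcont : ∀ w : Vec n, Continuous fun θ : Mat n m => ker Q p θ w :=
    continuous_ker_left hp0.le
  have hmeas : ∀ w : Vec n, AEStronglyMeasurable (fun θ : Mat n m => ker Q p θ w)
      (volume.restrict K) := fun w => (hcont w).aestronglyMeasurable
  have hint : Integrable (fun θ : Mat n m => ker Q p θ z) (volume.restrict K) :=
    (hcont z).continuousOn.integrableOn_compact hK
  have hmeas' : AEStronglyMeasurable (fun θ : Mat n m => fderiv ℝ (ker Q p θ) z)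
      (volume.restrict K) := (measurable_fderiv_ker hp0.le z).aestronglyMeasurable
  have hbound : Integrable (fun θ : Mat n m => C * (‖θ‖ ^ p * (‖z‖ + 1) ^ (p - 1)))
      (volume.restrict K) :=
    (Continuous.continuousOn (((continuous_norm.rpow_const fun _ => Or.inr hp0.le).mul
      continuous_const).const_mul C)).integrableOn_compact hK
  have hle : ∀ θ : Mat n m, ∀ w ∈ Metric.ball z 1,
      ‖fderiv ℝ (ker Q p θ) w‖ ≤ C * (‖θ‖ ^ p * (‖z‖ + 1) ^ (p - 1)) := by
    intro θ w hw
    refine (hC θ w).trans ?_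
    have : ‖w‖ ≤ ‖z‖ + 1 := by
      have := norm_sub_norm_le w z
      rw [mem_ball_iff_norm] at hw
      linarith
    have : ‖w‖ ^ (p - 1) ≤ (‖z‖ + 1) ^ (p - 1) :=
      Real.rpow_le_rpow (norm_nonneg _) this (by linarith)
    gcongr
  have hdiff : ∀ θ : Mat n m, ∀ w ∈ Metric.ball z 1,
      HasFDerivAt (ker Q p θ) (fderiv ℝ (ker Q p θ) w) w := fun θ w _ =>
    (hasFDerivAt_ker hQ hp θ w).differentiableAt.hasFDerivAt
  exact hasFDerivAt_integral_of_dominated_of_fderiv_le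
    (F := fun (z : Vec n) (θ : Mat n m) => ker Q p θ z)
    (F' := fun z θ => fderiv ℝ (ker Q p θ) z) (Metric.ball_mem_nhds z one_pos)
    (Eventually.of_forall hmeas) hint hmeas' (Eventually.of_forall hle) hbound
    (Eventually.of_forall hdiff)

theorem hasFDerivAt_suppLPow (hn : 1 ≤ n) (hm : 1 ≤ m) (hQ : Admissible n Q) (hp : 1 < p)
    (hG : MemLp G (ENNReal.ofReal p) volume) (hnd : Nondegenerate m G) (z : Vec n) :
    HasFDerivAt (suppLPow Q p G)
      (coef Q p G • ∫ θ in polarProj Q p G, fderiv ℝ (ker Q p θ) z) z :=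
  (hasFDerivAt_setIntegral_ker hQ hp
    (isCompact_polarProj hn hm hQ.1 (by linarith) hG hnd) z).const_mul _

/-- These are the growth conditions required by `hasDerivAt_integral_comp_add_smul`. -/
theorem exists_suppLPow_bounds (hn : 1 ≤ n) (hm : 1 ≤ m) (hQ : Admissible n Q) (hp : 1 < p)
    (hG : MemLp G (ENNReal.ofReal p) volume) (hnd : Nondegenerate m G) :
    ∃ C, 0 ≤ C ∧ (∀ z, |suppLPow Q p G z| ≤ C * ‖z‖ ^ p) ∧
      ∀ z, ‖fderiv ℝ (suppLPow Q p G) z‖ ≤ C * ‖z‖ ^ (p - 1) := by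
  have hp0 : 0 < p := by linarith
  have hK := isCompact_polarProj hn hm hQ.1 hp0 hG hnd
  obtain ⟨C, hC0, hC⟩ := exists_norm_fderiv_ker_le hQ hp
  obtain ⟨D, hD0, hD⟩ := exists_ker_le (n := n) hQ.1 hp0.le
  have hc := coef_nonneg (Q := Q) (G := G) hp0
  set I := ∫ θ in polarProj Q p G, ‖θ‖ ^ p
  have hI : 0 ≤ I := integral_nonneg fun θ => by positivity
  have hi1 : Integrable (fun θ : Mat n m => ‖θ‖ ^ p) (volume.restrict (polarProj Q p G)) :=
    (Continuous.continuousOn (continuous_norm.rpow_const fun _ =>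
      Or.inr hp0.le)).integrableOn_compact hK
  refine ⟨coef Q p G * ((C + D) * I), by positivity, fun z => ?_, fun z => ?_⟩
  · rw [suppLPow, abs_mul, abs_of_nonneg hc, mul_assoc]
    refine mul_le_mul_of_nonneg_left ?_ hc
    have h := norm_integral_le_of_norm_le (μ := volume.restrict (polarProj Q p G))
      (f := fun θ : Mat n m => ker Q p θ z) ((hi1.mul_const (‖z‖ ^ p)).const_mul D)
      (Eventually.of_forall fun θ => by
        rw [Real.norm_of_nonneg (ker_nonneg hQ.1 _ _)]; exact hD θ z)
    rw [integral_const_mul, integral_mul_const, Real.norm_eq_abs] at h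
    refine h.trans ?_
    rw [← mul_assoc]
    gcongr
    linarith
  · rw [(hasFDerivAt_suppLPow hn hm hQ hp hG hnd z).fderiv, norm_smul, Real.norm_of_nonneg hc,
      mul_assoc]
    refine mul_le_mul_of_nonneg_left ?_ hc
    have h := norm_integral_le_of_norm_le (μ := volume.restrict (polarProj Q p G))
      (f := fun θ : Mat n m => fderiv ℝ (ker Q p θ) z)
      ((hi1.mul_const (‖z‖ ^ (p - 1))).const_mul C) (Eventually.of_forall fun θ => hC θ z)
    rw [integral_const_mul, integral_mul_const] at h
    refine h.trans ?_
    rw [← mul_assoc]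
    gcongr
    linarith

/-- Euler's identity. -/
theorem fderiv_suppLPow_self (hn : 1 ≤ n) (hm : 1 ≤ m) (hQ : Admissible n Q) (hp : 1 < p)
    (hG : MemLp G (ENNReal.ofReal p) volume) (hnd : Nondegenerate m G) (z : Vec n) :
    fderiv ℝ (suppLPow Q p G) z z = p * suppLPow Q p G z := by
  -- The relation `H(a z) = a^p H(z)` is differentiated at `a = 1` in two ways.
  have h1 : HasDerivAt (fun a : ℝ => a • z) z 1 := by
    simpa using (hasDerivAt_id (1 : ℝ)).smul_const z
  have hd := (hasFDerivAt_suppLPow hn hm hQ hp hG hnd ((1 : ℝ) • z)).comp_hasDerivAt 1 h1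
  rw [one_smul, ← (hasFDerivAt_suppLPow hn hm hQ hp hG hnd z).fderiv] at hd
  have h2 : HasDerivAt (fun a : ℝ => a ^ p * suppLPow Q p G z) (p * suppLPow Q p G z) 1 := by
    simpa using (Real.hasDerivAt_rpow_const (p := p)
      (Or.inl one_ne_zero)).mul_const (suppLPow Q p G z)
  refine hd.unique (h2.congr_of_eventuallyEq ?_)
  filter_upwards [lt_mem_nhds one_pos] with a ha
  exact suppLPow_smul hQ.1 ha z

/-- The chain rule `h^(p-1) ∇h = p⁻¹ ∇(h^p)`, arranged to hold also at zeros of `h`, where `h` need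
not be differentiable. -/
theorem inner_flux (hn : 1 ≤ n) (hm : 1 ≤ m) (hQ : Admissible n Q) (hp : 1 < p)
    (hG : MemLp G (ENNReal.ofReal p) volume) (hnd : Nondegenerate m G) (x w : Vec n) :
    inner ℝ (flux Q p G x) w = p⁻¹ * fderiv ℝ (suppLPow Q p G) (G x) w := by
  have hp0 : 0 < p := by linarith
  have hH := (hasFDerivAt_suppLPow hn hm hQ hp hG hnd (G x)).differentiableAt
  have hs0 := suppL_nonneg (G := G) hQ.1 hp0 (G x)
  rw [flux, real_inner_smul_left]
  by_cases hz : suppL Q p G (G x) = 0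
  -- At a zero of `h_L` both sides vanish: `h_L ^ p` is at its minimum, and the factor `0 ^ (p - 1)`
  -- removes whatever value the gradient of `h_L` takes.
  · have hmin : IsLocalMin (suppLPow Q p G) (G x) := by
      refine Eventually.of_forall fun y => ?_
      rw [← suppL_rpow hQ.1 hp0, hz, Real.zero_rpow hp0.ne']
      exact suppLPow_nonneg hQ.1 hp0 y
    rw [hmin.fderiv_eq_zero, hz, Real.zero_rpow (by linarith)]
    simp
  · have hpos := hs0.lt_of_ne' hz
    have hfun : suppL Q p G = fun z => suppLPow Q p G z ^ (1 / p) := by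
      ext z
      rw [← suppL_rpow hQ.1 hp0, ← Real.rpow_mul (suppL_nonneg hQ.1 hp0 z),
        mul_one_div_cancel hp0.ne', Real.rpow_one]
    have hHpos : suppLPow Q p G (G x) ≠ 0 := by
      rw [← suppL_rpow hQ.1 hp0]
      exact (Real.rpow_pos_of_pos hpos _).ne'
    have hD := hH.hasFDerivAt.rpow_const (p := 1 / p) (Or.inl hHpos)
    rw [← hfun] at hD
    rw [inner_gradient_left, hD.fderiv, ← suppL_rpow hQ.1 hp0,
      ← Real.rpow_mul hs0]
    simp only [smul_apply, smul_eq_mul]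
    have : suppL Q p G (G x) ^ (p - 1) * suppL Q p G (G x) ^ (p * (1 / p - 1)) = 1 := by
      rw [← Real.rpow_add hpos, show p - 1 + p * (1 / p - 1) = 0 by field_simp; ring,
        Real.rpow_zero]
    linear_combination (1 / p * fderiv ℝ (suppLPow Q p G) (G x) w) * this

end suppLPow

/-! ### Sobolev functions: support, Poincaré inequality, nondegeneracy -/

section sobolev

variable {n m : ℕ} {Ω : Set (Vec n)} {p : ℝ}

theorem gradient_eq_zero_of_notMem_tsupport {φ : Vec n → ℝ} {x : Vec n} (hx : x ∉ tsupport φ) :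
    gradient φ x = 0 := by
  have : φ =ᶠ[𝓝 x] fun _ => 0 := notMem_tsupport_iff_eventuallyEq.1 hx
  rw [this.gradient_eq]
  simp [gradient]

theorem continuous_gradient {φ : Vec n → ℝ} (hφ : ContDiff ℝ ∞ φ) : Continuous (gradient φ) :=
  (InnerProductSpace.toDual ℝ (Vec n)).symm.continuous.comp (hφ.continuous_fderiv (by simp))

/-- Outside `Ω` the difference `ψ k - F` is `-F`, so the norm of `F` there is bounded by a sequence
tending to zero. -/
theorem ae_eq_zero_of_tendsto_eLpNorm {E : Type*} [NormedAddCommGroup E] (hp : 0 < p)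
    (hΩ : MeasurableSet Ω) {ψ : ℕ → Vec n → E} {F : Vec n → E}
    (hF : AEStronglyMeasurable F volume) (hψ : ∀ k, ∀ x ∉ Ω, ψ k x = 0)
    (h : Tendsto (fun k => eLpNorm (fun x => ψ k x - F x) (ENNReal.ofReal p) volume) atTop (𝓝 0)) :
    ∀ᵐ x, x ∉ Ω → F x = 0 := by
  have hle : ∀ k, eLpNorm F (ENNReal.ofReal p) (volume.restrict Ωᶜ) ≤
      eLpNorm (fun x => ψ k x - F x) (ENNReal.ofReal p) volume := by
    intro k
    refine le_trans (le_of_eq ?_) (eLpNorm_mono_measure _ (Measure.restrict_le_self (s := Ωᶜ)))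
    refine eLpNorm_congr_norm_ae ?_
    filter_upwards [ae_restrict_mem hΩ.compl] with x hx
    rw [hψ k x hx, zero_sub, norm_neg]
  have h0 : eLpNorm F (ENNReal.ofReal p) (volume.restrict Ωᶜ) = 0 :=
    le_antisymm (ge_of_tendsto' h hle) bot_le
  rw [eLpNorm_eq_zero_iff hF.restrict (by simpa using hp)] at h0
  exact (ae_restrict_iff' hΩ.compl).1 h0

theorem SobolevZero.toFun_ae_eq_zero (hp : 0 < p) (hΩ : MeasurableSet Ω) (f : SobolevZero Ω p) :
    ∀ᵐ x, x ∉ Ω → f.toFun x = 0 := by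
  obtain ⟨φ, hφ, h, -⟩ := f.exists_approx
  exact ae_eq_zero_of_tendsto_eLpNorm hp hΩ f.memLp_toFun.1
    (fun k x hx => image_eq_zero_of_notMem_tsupport fun h => hx ((hφ k).2.2 h)) h

theorem SobolevZero.grad_ae_eq_zero (hp : 0 < p) (hΩ : MeasurableSet Ω) (f : SobolevZero Ω p) :
    ∀ᵐ x, x ∉ Ω → f.grad x = 0 := by
  obtain ⟨φ, hφ, -, h⟩ := f.exists_approx
  exact ae_eq_zero_of_tendsto_eLpNorm hp hΩ f.memLp_grad.1
    (fun k x hx => gradient_eq_zero_of_notMem_tsupport fun h => hx ((hφ k).2.2 h)) h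

/-- The Poincaré inequality in one direction, for smooth functions. -/
theorem exists_lintegral_le_mul_lintegral_inner_gradient (hΩ : Bornology.IsBounded Ω) {v : Vec n}
    (hv : v ≠ 0) : ∃ R : ℝ, ∀ φ : Vec n → ℝ, ContDiff ℝ ∞ φ → tsupport φ ⊆ Ω →
      ∫⁻ x, ‖φ x‖ₑ ≤ ENNReal.ofReal R * ∫⁻ x, ‖inner ℝ (gradient φ x) v‖ₑ := by
  obtain ⟨M, hM⟩ := hΩ.exists_norm_le
  have hv' : 0 < ‖v‖ := norm_pos_iff.2 hv
  -- The shift `R • v` has length `2|M| + 1`, too long to join two points of `Ω`.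
  set R : ℝ := (2 * |M| + 1) / ‖v‖ with hR
  have hR0 : 0 ≤ R := by positivity
  have hout : ∀ x ∈ Ω, x + R • v ∉ Ω := by
    intro x hx hx'
    have h1 := hM _ hx
    have h2 := hM _ hx'
    have h3 := norm_sub_le (x + R • v) x
    rw [add_sub_cancel_left, norm_smul, Real.norm_of_nonneg hR0, hR,
      div_mul_cancel₀ _ hv'.ne'] at h3
    linarith [le_abs_self M]
  refine ⟨R, fun φ hφ hsupp => ?_⟩
  have hcont : Continuous fun x => inner ℝ (gradient φ x) v :=
    (continuous_gradient hφ).inner continuous_const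
  -- For `x ∈ Ω` the segment ends outside `Ω`, where `φ = 0`, so `-φ x` is the integral of the
  -- directional derivative along it.
  have hpt : ∀ x, ‖φ x‖ₑ ≤ ∫⁻ s in Set.Ioc 0 R, ‖inner ℝ (gradient φ (x + s • v)) v‖ₑ := by
    intro x
    by_cases hx : x ∈ Ω
    · have hz : φ (x + R • v) = 0 :=
        image_eq_zero_of_notMem_tsupport fun h => hout x hx (hsupp h)
      have hline : ∀ s : ℝ, HasDerivAt (fun s : ℝ => φ (x + s • v))
          (inner ℝ (gradient φ (x + s • v)) v) s := by
        intro s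
        have h1 : HasDerivAt (fun s : ℝ => x + s • v) v s := by
          simpa using ((hasDerivAt_id s).smul_const v).const_add x
        have h2 := ((hφ.differentiable (by simp)) (x + s • v)).hasFDerivAt.comp_hasDerivAt s h1
        rwa [inner_gradient_left]
      have hci : Continuous fun s : ℝ => inner ℝ (gradient φ (x + s • v)) v :=
        hcont.comp (by fun_prop : Continuous fun s : ℝ => x + s • v)
      have hftc := intervalIntegral.integral_eq_sub_of_hasDerivAt (a := 0) (b := R)
        (fun s _ => hline s) (hci.intervalIntegrable _ _)
      rw [hz, zero_smul, add_zero, zero_sub, intervalIntegral.integral_of_le hR0] at hftc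
      rw [← enorm_neg, ← hftc]
      exact enorm_integral_le_lintegral_enorm _
    · rw [image_eq_zero_of_notMem_tsupport fun h => hx (hsupp h)]
      simp
  have hjoint : Continuous fun y : Vec n × ℝ => ‖inner ℝ (gradient φ (y.1 + y.2 • v)) v‖ₑ :=
    (hcont.comp (by fun_prop : Continuous fun y : Vec n × ℝ => y.1 + y.2 • v)).enorm
  calc ∫⁻ x, ‖φ x‖ₑ
      ≤ ∫⁻ x, ∫⁻ s in Set.Ioc 0 R, ‖inner ℝ (gradient φ (x + s • v)) v‖ₑ := lintegral_mono hpt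
    _ = ∫⁻ s in Set.Ioc 0 R, ∫⁻ x, ‖inner ℝ (gradient φ (x + s • v)) v‖ₑ :=
      lintegral_lintegral_swap hjoint.measurable.aemeasurable
    _ = ∫⁻ s in Set.Ioc 0 R, ∫⁻ x, ‖inner ℝ (gradient φ x) v‖ₑ := by
      refine lintegral_congr fun s => ?_
      exact lintegral_add_right_eq_self (fun x => ‖inner ℝ (gradient φ x) v‖ₑ) (s • v)
    _ = _ := by
      rw [lintegral_const, Measure.restrict_apply_univ, Real.volume_Ioc, sub_zero, mul_comm]

theorem tendsto_lintegral_of_tendsto_eLpNorm {E : Type*} [NormedAddCommGroup E] (hp : 1 ≤ p)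
    (hΩ : Bornology.IsBounded Ω) {h : ℕ → Vec n → E} (hm : ∀ k, AEStronglyMeasurable (h k) volume)
    (hh : Tendsto (fun k => eLpNorm (h k) (ENNReal.ofReal p) volume) atTop (𝓝 0)) :
    Tendsto (fun k => ∫⁻ x in Ω, ‖h k x‖ₑ) atTop (𝓝 0) := by
  have hfin : (volume.restrict Ω) Set.univ ≠ ⊤ := by
    rw [Measure.restrict_apply_univ]
    exact hΩ.measure_lt_top.ne
  have hp0 : 0 < p := by linarith
  have hexp : 0 ≤ 1 / (1 : ℝ≥0∞).toReal - 1 / (ENNReal.ofReal p).toReal := by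
    rw [ENNReal.toReal_ofReal hp0.le, ENNReal.toReal_one, sub_nonneg]
    exact one_div_le_one_div_of_le one_pos hp
  have hlim := ENNReal.Tendsto.mul_const hh (Or.inr (ENNReal.rpow_ne_top_of_nonneg hexp hfin))
  rw [zero_mul] at hlim
  refine tendsto_of_tendsto_of_tendsto_of_le_of_le tendsto_const_nhds hlim (fun _ => bot_le)
    fun k => ?_
  simp only
  rw [← eLpNorm_one_eq_lintegral_enorm]
  refine (eLpNorm_le_eLpNorm_mul_rpow_measure_univ (ENNReal.one_le_ofReal.2 hp)
    (hm k).restrict).trans ?_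
  gcongr
  exact Measure.restrict_le_self

/-- The Poincaré inequality passes to the limit: `⟨∇φ_k, v⟩ = ⟨∇φ_k - ∇f, v⟩` tends to zero in
`L¹(Ω)`, hence so does `φ_k`, whose limit is `f`. -/
theorem SobolevZero.ae_eq_zero_of_inner_grad (hp : 1 ≤ p) (hΩ : MeasurableSet Ω)
    (hΩb : Bornology.IsBounded Ω) (f : SobolevZero Ω p) {v : Vec n} (hv : v ≠ 0)
    (hf : ∀ᵐ x, inner ℝ (f.grad x) v = 0) : f.toFun =ᵐ[volume] 0 := by
  obtain ⟨φ, hφ, h1, h2⟩ := f.exists_approx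
  obtain ⟨R, hR⟩ := exists_lintegral_le_mul_lintegral_inner_gradient hΩb hv
  have hφm : ∀ k, AEStronglyMeasurable (φ k) volume := fun k =>
    (hφ k).1.continuous.aestronglyMeasurable
  have t1 := tendsto_lintegral_of_tendsto_eLpNorm hp hΩb
    (fun k => (hφm k).sub f.memLp_toFun.1) h1
  have t2 := tendsto_lintegral_of_tendsto_eLpNorm hp hΩb
    (fun k => (continuous_gradient (hφ k).1).aestronglyMeasurable.sub f.memLp_grad.1) h2
  have hle : ∀ k, ∫⁻ x in Ω, ‖f.toFun x‖ₑ ≤ (∫⁻ x in Ω, ‖φ k x - f.toFun x‖ₑ) +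
      ENNReal.ofReal R * (‖v‖ₑ * ∫⁻ x in Ω, ‖gradient (φ k) x - f.grad x‖ₑ) := by
    intro k
    have hsplit : ∫⁻ x in Ω, ‖f.toFun x‖ₑ ≤
        ∫⁻ x in Ω, (‖φ k x - f.toFun x‖ₑ + ‖φ k x‖ₑ) := by
      refine lintegral_mono fun x => ?_
      have := enorm_sub_le (a := φ k x) (b := φ k x - f.toFun x)
      rwa [sub_sub_cancel, add_comm] at this
    rw [lintegral_add_right _ (hφ k).1.continuous.enorm.measurable] at hsplit
    refine hsplit.trans (add_le_add_right ?_ _)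
    refine (setLIntegral_le_lintegral _ _).trans ((hR _ (hφ k).1 (hφ k).2.2).trans ?_)
    refine mul_le_mul_right ?_ _
    have hΩint : ∫⁻ x, ‖inner ℝ (gradient (φ k) x) v‖ₑ =
        ∫⁻ x in Ω, ‖inner ℝ (gradient (φ k) x) v‖ₑ := by
      refine (setLIntegral_eq_of_support_subset fun x hx => ?_).symm
      by_contra hxΩ
      refine hx ?_
      simp [gradient_eq_zero_of_notMem_tsupport fun h => hxΩ ((hφ k).2.2 h)]
    rw [hΩint, ← lintegral_const_mul' _ _ enorm_ne_top]
    refine lintegral_mono_ae ?_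
    filter_upwards [ae_restrict_of_ae hf] with x hx
    have : inner ℝ (gradient (φ k) x) v = inner ℝ (gradient (φ k) x - f.grad x) v := by
      rw [inner_sub_left, hx, sub_zero]
    rw [this, mul_comm]
    simp only [← ofReal_norm]
    rw [← ENNReal.ofReal_mul (norm_nonneg _)]
    exact ENNReal.ofReal_le_ofReal (norm_inner_le_norm _ _)
  have hlim : Tendsto (fun k => (∫⁻ x in Ω, ‖φ k x - f.toFun x‖ₑ) +
      ENNReal.ofReal R * (‖v‖ₑ * ∫⁻ x in Ω, ‖gradient (φ k) x - f.grad x‖ₑ)) atTop (𝓝 0) := by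
    have := t1.add (ENNReal.Tendsto.const_mul (a := ENNReal.ofReal R)
      (ENNReal.Tendsto.const_mul (a := ‖v‖ₑ) t2 (Or.inr enorm_ne_top))
      (Or.inr ENNReal.ofReal_ne_top))
    simpa using this
  have h0 : ∫⁻ x in Ω, ‖f.toFun x‖ₑ = 0 := le_antisymm (ge_of_tendsto' hlim hle) bot_le
  rw [lintegral_eq_zero_iff' f.memLp_toFun.1.restrict.enorm] at h0
  filter_upwards [(ae_restrict_iff' hΩ).1 h0, f.toFun_ae_eq_zero (by linarith) hΩ] with x hx hx'
  by_cases hxΩ : x ∈ Ω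
  · simpa using hx hxΩ
  · exact hx' hxΩ

theorem SobolevZero.Nonzero.nondegenerate (hp : 1 ≤ p) (hΩ : MeasurableSet Ω)
    (hΩb : Bornology.IsBounded Ω) {f : SobolevZero Ω p} (hf : f.Nonzero) :
    Nondegenerate m f.grad := by
  intro θ hθ
  ext ⟨i, j⟩
  by_contra hij
  -- A nonzero column of `θ` is a direction in which the derivative of `f` vanishes.
  let v : Vec n := WithLp.toLp 2 fun i => θ (i, j)
  have hv : v ≠ 0 := fun h => hij (congrArg (fun w : Vec n => w i) h)
  refine hf (f.ae_eq_zero_of_inner_grad hp hΩ hΩb hv ?_)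
  filter_upwards [hθ] with x hx
  have := congrArg (fun w : Vec m => w j) hx
  simpa [v, tmul, PiLp.inner_apply] using this

theorem tendsto_eLpNorm_add_smul {E : Type*} [NormedAddCommGroup E] [NormedSpace ℝ E]
    {r : ℝ≥0∞} (hr : 1 ≤ r) {h h' : ℕ → Vec n → E}
    (hm : ∀ k, AEStronglyMeasurable (h k) volume) (hm' : ∀ k, AEStronglyMeasurable (h' k) volume)
    (hh : Tendsto (fun k => eLpNorm (h k) r volume) atTop (𝓝 0))
    (hh' : Tendsto (fun k => eLpNorm (h' k) r volume) atTop (𝓝 0)) (t : ℝ) :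
    Tendsto (fun k => eLpNorm (fun x => h k x + t • h' k x) r volume) atTop (𝓝 0) := by
  have hlim : Tendsto (fun k => eLpNorm (h k) r volume + ‖t‖ₑ * eLpNorm (h' k) r volume)
      atTop (𝓝 0) := by
    simpa using hh.add (ENNReal.Tendsto.const_mul (a := ‖t‖ₑ) hh' (Or.inr enorm_ne_top))
  refine tendsto_of_tendsto_of_tendsto_of_le_of_le tendsto_const_nhds hlim (fun _ => bot_le)
    fun k => ?_
  refine (eLpNorm_add_le (hm k) ((hm' k).const_smul t) hr).trans ?_
  rw [eLpNorm_const_smul]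

theorem gradient_add_smul {φ ψ : Vec n → ℝ} (hφ : ContDiff ℝ ∞ φ) (hψ : ContDiff ℝ ∞ ψ) (t : ℝ)
    (x : Vec n) :
    gradient (fun y => φ y + t • ψ y) x = gradient φ x + t • gradient ψ x := by
  have h1 := (hφ.differentiable (by simp)) x
  have h2 := (hψ.differentiable (by simp)) x
  have : fderiv ℝ (fun y => φ y + t • ψ y) x = fderiv ℝ φ x + t • fderiv ℝ ψ x :=
    (h1.hasFDerivAt.add (h2.hasFDerivAt.const_smul t)).fderiv
  rw [gradient, this, map_add, map_smul]
  rfl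

/-- Makes the variation `f + tφ` an admissible competitor. -/
theorem SobolevZero.exists_add_smul (hp : 1 ≤ p) (f g : SobolevZero Ω p) (t : ℝ) :
    ∃ h : SobolevZero Ω p, (h.toFun = fun x => f.toFun x + t • g.toFun x) ∧
      h.grad = fun x => f.grad x + t • g.grad x := by
  obtain ⟨φ, hφ, hφ1, hφ2⟩ := f.exists_approx
  obtain ⟨ψ, hψ, hψ1, hψ2⟩ := g.exists_approx
  have hr : 1 ≤ ENNReal.ofReal p := ENNReal.one_le_ofReal.2 hp
  refine ⟨⟨_, _, f.memLp_toFun.add (g.memLp_toFun.const_smul t),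
    f.memLp_grad.add (g.memLp_grad.const_smul t), fun k x => φ k x + t • ψ k x,
    fun k => ⟨(hφ k).1.add ((hψ k).1.const_smul t), ?_, ?_⟩, ?_, ?_⟩, rfl, rfl⟩
  · exact (hφ k).2.1.add ((hψ k).2.1.smul_left (f := fun _ => t))
  · refine (tsupport_add _ _).trans (Set.union_subset (hφ k).2.2 ?_)
    exact (closure_mono (Function.support_const_smul_subset t (ψ k))).trans (hψ k).2.2
  · have := tendsto_eLpNorm_add_smul hr
      (fun k => (hφ k).1.continuous.aestronglyMeasurable.sub f.memLp_toFun.1)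
      (fun k => (hψ k).1.continuous.aestronglyMeasurable.sub g.memLp_toFun.1) hφ1 hψ1 t
    refine this.congr fun k => ?_
    congr 1
    ext x
    simp only [Pi.add_apply, Pi.sub_apply, Pi.smul_apply, smul_eq_mul]
    ring
  · have := tendsto_eLpNorm_add_smul hr
      (fun k => (continuous_gradient (hφ k).1).aestronglyMeasurable.sub f.memLp_grad.1)
      (fun k => (continuous_gradient (hψ k).1).aestronglyMeasurable.sub g.memLp_grad.1) hφ2 hψ2 t
    refine this.congr fun k => ?_
    congr 1
    ext1 x
    rw [gradient_add_smul (hφ k).1 (hψ k).1]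
    simp only [Pi.add_apply, Pi.sub_apply, Pi.smul_apply, smul_sub]
    abel

end sobolev

theorem rpow_sub_two_mul_self_mul_self {q : ℝ} (hq : 1 < q) (s : ℝ) :
    |s| ^ (q - 2) * s * s = |s| ^ q := by
  by_cases hs : s = 0
  · simp [hs, Real.zero_rpow (by linarith : q ≠ 0)]
  · have h := Real.rpow_add (abs_pos.2 hs) (q - 2) 2
    rw [sub_add_cancel, Real.rpow_two, sq_abs] at h
    rw [h]; ring

theorem norm_fderiv_abs_rpow {q : ℝ} (hq : 1 < q) (s : ℝ) :
    ‖fderiv ℝ (fun s : ℝ => |s| ^ q) s‖ = q * ‖s‖ ^ (q - 1) := by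
  rw [← norm_deriv_eq_norm_fderiv, (hasDerivAt_abs_rpow s hq).deriv, norm_mul, norm_mul,
    Real.norm_of_nonneg (by linarith : 0 ≤ q), Real.norm_of_nonneg (by positivity), mul_assoc,
    Real.norm_eq_abs]
  congr 1
  by_cases hs : s = 0
  · simp [hs, Real.zero_rpow (by linarith : q - 1 ≠ 0)]
  · rw [← Real.rpow_add_one (abs_pos.2 hs).ne']
    congr 1; ring

/-! ### The Euler–Lagrange equation and eigenvalues -/

section variation

variable {n m : ℕ} {Ω : Set (Vec n)} {p q : ℝ} {Q : ConvexBody (Vec m)}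

theorem SobolevZero.memLp_restrict (hΩb : Bornology.IsBounded Ω) (hqp : q ≤ p)
    (f : SobolevZero Ω p) : MemLp f.toFun (ENNReal.ofReal q) (volume.restrict Ω) := by
  have : IsFiniteMeasure (volume.restrict Ω) :=
    ⟨by rw [Measure.restrict_apply_univ]; exact hΩb.measure_lt_top⟩
  exact (f.memLp_toFun.restrict Ω).mono_exponent (ENNReal.ofReal_le_ofReal hqp)

theorem SobolevZero.Nonzero.setIntegral_pos (hq : 0 < q) (hqp : q ≤ p) (hΩ : MeasurableSet Ω)
    (hΩb : Bornology.IsBounded Ω) {f : SobolevZero Ω p} (hf : f.Nonzero) :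
    0 < ∫ x in Ω, |f.toFun x| ^ q := by
  refine (integral_nonneg fun x => by positivity).lt_of_ne' fun h => hf ?_
  have hi : Integrable (fun x => |f.toFun x| ^ q) (volume.restrict Ω) :=
    integrable_norm_rpow_of_memLp hq (f.memLp_restrict hΩb hqp)
  rw [integral_eq_zero_iff_of_nonneg (fun x => by positivity) hi] at h
  filter_upwards [(ae_restrict_iff' hΩ).1 h, f.toFun_ae_eq_zero (by linarith) hΩ] with x hx hx'
  by_cases hxΩ : x ∈ Ω
  · have := (Real.rpow_eq_zero (abs_nonneg _) hq.ne').1 (hx hxΩ)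
    simpa using this
  · exact hx' hxΩ

theorem lqNorm_rpow (s : ℝ) (u : Vec n → ℝ) :
    lqNorm Ω q u ^ s = (∫ x in Ω, |u x| ^ q) ^ (s / q) := by
  rw [lqNorm, ← Real.rpow_mul (integral_nonneg fun x => by positivity), one_div_mul_eq_div]

theorem SobolevZero.Nonzero.lqNorm_pos (hq : 0 < q) (hqp : q ≤ p) (hΩ : MeasurableSet Ω)
    (hΩb : Bornology.IsBounded Ω) {f : SobolevZero Ω p} (hf : f.Nonzero) :
    0 < lqNorm Ω q f.toFun :=
  Real.rpow_pos_of_pos (hf.setIntegral_pos hq hqp hΩ hΩb) _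

theorem inner_flux_integrable_and_setIntegral (hn : 1 ≤ n) (hm : 1 ≤ m) (hΩ : MeasurableSet Ω)
    (hQ : Admissible n Q) (hp : 1 < p) {f : SobolevZero Ω p} (hnd : Nondegenerate m f.grad)
    (φ : SobolevZero Ω p) :
    IntegrableOn (fun x => inner ℝ (flux Q p f.grad x) (φ.grad x)) Ω volume ∧
    ∫ x in Ω, inner ℝ (flux Q p f.grad x) (φ.grad x) =
      p⁻¹ * ∫ x, fderiv ℝ (suppLPow Q p f.grad) (f.grad x) (φ.grad x) := by
  obtain ⟨C, hC, hb, hb'⟩ := exists_suppLPow_bounds hn hm hQ hp f.memLp_grad hnd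
  have hJ := hasDerivAt_integral_comp_add_smul hp hC
    (fun z => (hasFDerivAt_suppLPow hn hm hQ hp f.memLp_grad hnd z).differentiableAt) hb hb'
    f.memLp_grad φ.memLp_grad
  simp only [inner_flux hn hm hQ hp f.memLp_grad hnd]
  refine ⟨(hJ.1.const_mul _).integrableOn, ?_⟩
  rw [integral_const_mul, setIntegral_eq_integral_of_ae_compl_eq_zero]
  filter_upwards [φ.grad_ae_eq_zero (by linarith) hΩ] with x hx hxΩ
  rw [hx hxΩ, map_zero]

/-- A function at which the affine Sobolev inequality with constant `μ` is an equality satisfies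
the Euler-Lagrange equation. -/
theorem isWeakSolution_of_forall_le (hn : 1 ≤ n) (hm : 1 ≤ m) (hΩ : MeasurableSet Ω)
    (hΩb : Bornology.IsBounded Ω) (hQ : Admissible n Q) (hq : 1 < q) (hqp : q ≤ p)
    {f : SobolevZero Ω p} (hf : f.Nonzero) {μ : ℝ}
    (hle : ∀ g : SobolevZero Ω p, g.Nonzero →
      μ * lqNorm Ω q g.toFun ^ p ≤ energy Q p g.grad ^ p)
    (heq : μ * lqNorm Ω q f.toFun ^ p = energy Q p f.grad ^ p) :
    IsWeakSolution Q f fun x =>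
      μ * lqNorm Ω q f.toFun ^ (p - q) * (|f.toFun x| ^ (q - 2) * f.toFun x) := by
  intro φ
  have hp : 1 < p := hq.trans_le hqp
  have hp0 : 0 < p := by linarith
  have hq0 : 0 < q := by linarith
  have hnd : Nondegenerate m f.grad := hf.nondegenerate hp.le hΩ hΩb
  set H := suppLPow Q p f.grad
  obtain ⟨C, hC, hb, hb'⟩ := exists_suppLPow_bounds hn hm hQ hp f.memLp_grad hnd
  have hJ := hasDerivAt_integral_comp_add_smul hp hC
    (fun z => (hasFDerivAt_suppLPow hn hm hQ hp f.memLp_grad hnd z).differentiableAt) hb hb'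
    f.memLp_grad φ.memLp_grad
  have hA := hasDerivAt_integral_comp_add_smul hq hq0.le (H := fun s : ℝ => |s| ^ q)
    (fun s => (hasDerivAt_abs_rpow s hq).differentiableAt)
    (fun s => by
      rw [abs_of_nonneg (by positivity), Real.norm_eq_abs]
      exact le_mul_of_one_le_left (by positivity) hq.le)
    (fun s => (norm_fderiv_abs_rpow hq s).le) (f.memLp_restrict hΩb hqp)
    (φ.memLp_restrict hΩb hqp)
  have hfd : ∀ x, fderiv ℝ (fun s : ℝ => |s| ^ q) (f.toFun x) (φ.toFun x) =
      q * (|f.toFun x| ^ (q - 2) * f.toFun x * φ.toFun x) := by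
    intro x
    rw [(hasDerivAt_abs_rpow (f.toFun x) hq).hasFDerivAt.fderiv]
    simp only [ContinuousLinearMap.toSpanSingleton_apply, smul_eq_mul]
    ring
  simp only [hfd, integral_const_mul] at hA
  obtain ⟨hAint, hAd⟩ := hA
  replace hAint : Integrable (fun x => |f.toFun x| ^ (q - 2) * f.toFun x * φ.toFun x)
      (volume.restrict Ω) := by
    refine (hAint.const_mul q⁻¹).congr (Eventually.of_forall fun x => ?_)
    simp only
    rw [inv_mul_cancel_left₀ hq0.ne']
  set D := ∫ x in Ω, |f.toFun x| ^ (q - 2) * f.toFun x * φ.toFun x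
  set A : ℝ → ℝ := fun t => ∫ x in Ω, |f.toFun x + t • φ.toFun x| ^ q
  have hA0 : A 0 = ∫ x in Ω, |f.toFun x| ^ q := by simp [A]
  have hApos : 0 < A 0 := hA0 ▸ hf.setIntegral_pos hq0 hqp hΩ hΩb
  -- Since `p / q` is arbitrary above one, `A 0 > 0` is supplied for the chain rule; `f` being
  -- nonzero provides it.
  have hAp := (hAd.rpow_const (p := p / q) (Or.inl hApos.ne')).const_mul μ
  have hdiff := hJ.2.sub hAp
  -- For `g = f + tφ` nonzero, `∫ H(∇g) ≥ E(g)^p ≥ μ ‖g‖_q^p`, with equality throughout at `t = 0`.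
  have hmin : IsLocalMin ((fun t : ℝ => ∫ x, H (f.grad x + t • φ.grad x)) -
      fun t => μ * A t ^ (p / q)) 0 := by
    refine Eventually.of_forall fun t => ?_
    simp only [Pi.sub_apply, zero_smul, add_zero, hA0]
    have h0 : ∫ x, H (f.grad x) = μ * (∫ x in Ω, |f.toFun x| ^ q) ^ (p / q) := by
      rw [integral_suppLPow hn hm hQ.1 hp0 f.memLp_grad hnd f.memLp_grad,
        ← energy_rpow_eq hn hm hQ.1 hp0 f.memLp_grad hnd, ← heq, lqNorm_rpow]
    rw [h0, sub_self, sub_nonneg]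
    obtain ⟨g, hg, hg'⟩ := f.exists_add_smul hp.le φ t
    have hgA : A t = ∫ x in Ω, |g.toFun x| ^ q := by rw [hg]
    have hgH : ∫ x, H (f.grad x + t • φ.grad x) = ∫ x, H (g.grad x) := by rw [hg']
    rw [hgA, hgH]
    by_cases hg0 : g.Nonzero
    · rw [← lqNorm_rpow]
      refine (hle g hg0).trans ?_
      rw [integral_suppLPow hn hm hQ.1 hp0 f.memLp_grad hnd g.memLp_grad]
      exact energy_rpow_le hn hm hQ.1 hp0 f.memLp_grad hnd g.memLp_grad
        (hg0.nondegenerate hp.le hΩ hΩb)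
    -- If `f + tφ` vanishes, the energy comparison does not apply, but `H ≥ 0` suffices.
    · have hz : ∫ x in Ω, |g.toFun x| ^ q = 0 := by
        refine integral_eq_zero_of_ae (ae_restrict_of_ae ?_)
        filter_upwards [not_not.1 hg0] with x hx
        simp [hx, hq0.ne']
      rw [hz, Real.zero_rpow (by positivity), mul_zero]
      exact integral_nonneg fun x => suppLPow_nonneg hQ.1 hp0 _
  have hcrit := hmin.hasDerivAt_eq_zero hdiff
  obtain ⟨hfi, hfe⟩ := inner_flux_integrable_and_setIntegral hn hm hΩ hQ hp hnd φ
  have hr : ∀ x, μ * lqNorm Ω q f.toFun ^ (p - q) * (|f.toFun x| ^ (q - 2) * f.toFun x) *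
      φ.toFun x = μ * lqNorm Ω q f.toFun ^ (p - q) *
        (|f.toFun x| ^ (q - 2) * f.toFun x * φ.toFun x) := fun x => by ring
  simp only [hr]
  refine ⟨hfi, hAint.const_mul _, ?_⟩
  rw [hfe, integral_const_mul, lqNorm_rpow, ← hA0, sub_eq_zero.1 hcrit,
    show (p - q) / q = p / q - 1 by field_simp]
  field_simp
  rfl

/-- Testing the equation with `φ = g`, Euler's identity turns the left side into `∫ H(∇g) = E(g)^p`.
Hence no eigenvalue lies below the infimum of the Rayleigh quotient. -/
theorem IsEigenfunction.rayleigh_eq (hn : 1 ≤ n) (hm : 1 ≤ m) (hΩ : MeasurableSet Ω)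
    (hΩb : Bornology.IsBounded Ω) (hQ : Admissible n Q) (hp : 1 < p) {μ : ℝ}
    {g : SobolevZero Ω p} (hg : IsEigenfunction Q μ g) : rayleigh Q g = μ := by
  have hp0 : 0 < p := by linarith
  have hnd : Nondegenerate m g.grad := hg.1.nondegenerate hp.le hΩ hΩb
  have h := (hg.2 g).2.2
  rw [(inner_flux_integrable_and_setIntegral hn hm hΩ hQ hp hnd g).2] at h
  simp only [fderiv_suppLPow_self hn hm hQ hp g.memLp_grad hnd, integral_const_mul, mul_assoc] at h
  simp only [← mul_assoc, rpow_sub_two_mul_self_mul_self hp, inv_mul_cancel₀ hp0.ne',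
    one_mul] at h
  rw [integral_suppLPow hn hm hQ.1 hp0 g.memLp_grad hnd g.memLp_grad,
    ← energy_rpow_eq hn hm hQ.1 hp0 g.memLp_grad hnd] at h
  rw [rayleigh, lqNorm_rpow, div_self hp0.ne', Real.rpow_one, h,
    mul_div_cancel_right₀ _ (hg.1.setIntegral_pos hp0 le_rfl hΩ hΩb).ne']

end variation

end AffineLaplace

theorem proposition4p4 (n m : ℕ) (hn : 1 ≤ n) (hm : 1 ≤ m)
    (Ω : Set (Vec n)) (hΩ : IsOpen Ω) (hΩb : Bornology.IsBounded Ω)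
    (Q : ConvexBody (Vec m)) (hQ : Admissible n Q)
    (p q : ℝ) (hq : 1 < q) (hqp : q ≤ p) :
    (∀ f : SobolevZero Ω p, f.Nonzero → rayleighQ Q q f = lambdaQ Q Ω p q →
      IsWeakSolution Q f fun x =>
        lambdaQ Q Ω p q ^ p * lqNorm Ω q f.toFun ^ (p - q) *
          (|f.toFun x| ^ (q - 2) * f.toFun x)) ∧
    (∀ f : SobolevZero Ω p, f.Nonzero → rayleigh Q f = lambdaOne Q Ω p →
      IsEigenfunction Q (lambdaOne Q Ω p) f ∧
        IsLeast {μ : ℝ | ∃ g : SobolevZero Ω p, IsEigenfunction Q μ g} (lambdaOne Q Ω p)) := by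
  have hΩm := hΩ.measurableSet
  have hp : 1 < p := hq.trans_le hqp
  have hq0 : 0 < q := by linarith
  have hp0 : 0 < p := by linarith
  have hlq : ∀ (s : ℝ) (u : Vec n → ℝ), 0 ≤ lqNorm Ω s u := fun s u =>
    Real.rpow_nonneg (integral_nonneg fun x => by positivity) _
  refine ⟨fun f hf hfl => ?_, fun f hf hfl => ?_⟩
  · have hnn : ∀ g : SobolevZero Ω p, 0 ≤ rayleighQ Q q g := fun g =>
      div_nonneg (energy_nonneg hQ.1) (hlq _ _)
    have hl0 : 0 ≤ lambdaQ Q Ω p q := hfl ▸ hnn f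
    refine isWeakSolution_of_forall_le hn hm hΩm hΩb hQ hq hqp hf (fun g hg => ?_) ?_
    · have hle : lambdaQ Q Ω p q ≤ rayleighQ Q q g :=
        -- The real `sInf` is a lower bound only for sets bounded below; nonnegativity of the
        -- quotient supplies the bound `0`.
        csInf_le ⟨0, by rintro _ ⟨g, -, rfl⟩; exact hnn g⟩ ⟨g, hg, rfl⟩
      rw [rayleighQ, le_div_iff₀ (hg.lqNorm_pos hq0 hqp hΩm hΩb)] at hle
      rw [← Real.mul_rpow hl0 (hlq _ _)]
      exact Real.rpow_le_rpow (mul_nonneg hl0 (hlq _ _)) hle hp0.le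
    · rw [rayleighQ, div_eq_iff (hf.lqNorm_pos hq0 hqp hΩm hΩb).ne'] at hfl
      rw [← Real.mul_rpow hl0 (hlq _ _), hfl]
  · have hlower : ∀ g : SobolevZero Ω p, g.Nonzero → lambdaOne Q Ω p ≤ rayleigh Q g :=
      fun g hg => csInf_le ⟨0, by
        rintro _ ⟨g, -, rfl⟩
        exact div_nonneg (Real.rpow_nonneg (energy_nonneg hQ.1) _)
          (Real.rpow_nonneg (hlq _ _) _)⟩ ⟨g, hg, rfl⟩
    have hpos : ∀ g : SobolevZero Ω p, g.Nonzero → 0 < lqNorm Ω p g.toFun ^ p := fun g hg =>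
      Real.rpow_pos_of_pos (hg.lqNorm_pos hp0 le_rfl hΩm hΩb) _
    -- The case `q = p`, in which the factor `‖f‖^(p-q)` becomes `1`.
    have hweak := isWeakSolution_of_forall_le hn hm hΩm hΩb hQ hp le_rfl hf
      (μ := lambdaOne Q Ω p) (fun g hg => (le_div_iff₀ (hpos g hg)).1 (hlower g hg))
      ((div_eq_iff (hpos f hf).ne').1 hfl).symm
    simp only [sub_self, Real.rpow_zero, mul_one] at hweak
    have heig : IsEigenfunction Q (lambdaOne Q Ω p) f := ⟨hf, hweak⟩
    refine ⟨heig, ⟨f, heig⟩, ?_⟩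
    rintro μ ⟨g, hg⟩
    rw [← hg.rayleigh_eq hn hm hΩm hΩb hQ hp]
    exact hlower g hg.1
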